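/- Let $a>0$ and $c_+,c_-\in\mathbb C$, and let $H$ be the operator in $L^2(-a,a)$ given by $$H\psi=-\psi'',\qquad \mathrm{Dom}(H)=\{\psi\in W^{2,2}(-a,a):\ \psi'(\pm a)+c_\pm\psi(\pm a)=0\}.$$ The inner product $\langle\cdot,\cdot\rangle$ of $L^2(-a,a)$ is antilinear in the first slot. Assume that all eigenvalues of $H$ are simple (algebraic multiplicity one). Let $\lambda_n=l_n^2$, $n=0,1,2,\dots$, $l_n\in\mathbb C$, be an enumeration without repetition of all eigenvalues of $H$, and let $$\phi_n(x)=\frac1{\sqrt a}\Big(\cos\big(\overline{l_n}(x+a)\big)-\frac{\overline{c_-}}{\overline{l_n}}\sin\big(\overline{l_n}(x+a)\big)\Big),$$ where for $l_n=0$ the quotient $\sin(\overline{l_n}(x+a))/\overline{l_n}$ is read as $x+a$. Let $(e_n)_{n\ge0}$ be any orthonormal basis of $L^2(-a,a)$. Then each $\phi_n$ is an eigenfunction of the adjoint: $H^*\phi_n=\overline{\lambda_n}\phi_n$, $\phi_n\neq0$; the strongly convergent series $\Omega=\sum_{n=0}^\infty e_n\langle\phi_n,\cdot\rangle$ defines a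 bounded operator on $L^2(-a,a)$; and the operator $\Theta:=\Omega^*\Omega$ satisfies $$\Theta=\sum_{n=0}^\infty\phi_n\langle\phi_n,\cdot\rangle=I+K,$$ where the series converges strongly (both series converge unconditionally on every vector), and $K$ is a Hilbert–Schmidt operator that is an integral operator, $(Ku)(x)=\int_{-a}^a k(x,y)u(y)\,dy$ for almost every $x\in(-a,a)$ and every $u\in L^2(-a,a)$, with a kernel $k\in L^2((-a,a)\times(-a,a))$. -/

import Mathlib

open MeasureTheory
open scoped InnerProductSpace LinearPMap ComplexConjugate

noncomputable section

namespace RobinLaplacian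

/-- Lebesgue measure on the open interval `(-a, a)`. -/
abbrev intervalMeasure (a : ℝ) : Measure ℝ := volume.restrict (Set.Ioo (-a) a)

/-- The complex Hilbert space `L²(-a, a)`; its inner product is antilinear in the first slot. -/
abbrev L2 (a : ℝ) : Type := Lp ℂ 2 (intervalMeasure a)

/-- `f` is absolutely continuous on `[-a, a]` with (almost everywhere, equivalently weak)
derivative `g`: `g` is integrable and `f` is its primitive. -/
def HasACDeriv (a : ℝ) (f g : ℝ → ℂ) : Prop :=
  IntervalIntegrable g volume (-a) a ∧
    ∀ x ∈ Set.Icc (-a) a, f x = f (-a) + ∫ t in (-a)..x, g t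

lemma HasACDeriv.add {a : ℝ} {f g f' g' : ℝ → ℂ} (h : HasACDeriv a f g)
    (h' : HasACDeriv a f' g') : HasACDeriv a (f + f') (g + g') := by
  refine ⟨h.1.add h'.1, fun x hx => ?_⟩
  have hsub : Set.uIcc (-a) x ⊆ Set.uIcc (-a) a := by
    rw [Set.uIcc_of_le hx.1, Set.uIcc_of_le (hx.1.trans hx.2)]
    exact Set.Icc_subset_Icc_right hx.2
  have e := intervalIntegral.integral_add (h.1.mono_set hsub) (h'.1.mono_set hsub)
  simp only [Pi.add_apply]
  rw [e, h.2 x hx, h'.2 x hx]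
  ring

lemma HasACDeriv.smul {a : ℝ} {f g : ℝ → ℂ} (c : ℂ) (h : HasACDeriv a f g) :
    HasACDeriv a (c • f) (c • g) := by
  refine ⟨h.1.smul c, fun x hx => ?_⟩
  simp only [Pi.smul_apply]
  rw [intervalIntegral.integral_smul, h.2 x hx, smul_add]

/-- If an absolutely continuous function vanishes almost everywhere on `(-a, a)`, then it vanishes
on `[-a, a]` and so does its derivative almost everywhere. -/
lemma HasACDeriv.eq_zero {a : ℝ} (ha : 0 < a) {f g : ℝ → ℂ} (h : HasACDeriv a f g)
    (hf : f =ᵐ[intervalMeasure a] 0) : g =ᵐ[intervalMeasure a] 0 := by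
  have hle : -a ≤ a := by linarith
  have hcont : ContinuousOn f (Set.Icc (-a) a) := by
    have h1 := intervalIntegral.continuousOn_primitive_interval' h.1
      (Set.left_mem_uIcc (a := -a) (b := a))
    rw [Set.uIcc_of_le hle] at h1
    exact (continuousOn_const.add h1).congr fun x hx => h.2 x hx
  have hzero : ∀ x ∈ Set.Ioo (-a) a, f x = 0 := by
    have := Measure.eqOn_open_of_ae_eq (μ := volume) (U := Set.Ioo (-a) a) (f := f) (g := 0) hf
      isOpen_Ioo (hcont.mono Set.Ioo_subset_Icc_self) continuousOn_const
    exact fun x hx => this hx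
  have hd := h.1.ae_hasDerivAt_integral
  refine (ae_restrict_iff' measurableSet_Ioo).2 ?_
  filter_upwards [hd] with x hx hxI
  have hx' := hx (by rw [Set.uIcc_of_le hle]; exact Set.Ioo_subset_Icc_self hxI) (-a)
    Set.left_mem_uIcc
  have hev : (fun y => ∫ t in (-a)..y, g t) =ᶠ[nhds x] fun _ => -f (-a) := by
    filter_upwards [isOpen_Ioo.mem_nhds hxI] with y hy
    have e := h.2 y (Set.Ioo_subset_Icc_self hy)
    rw [hzero y hy] at e
    linear_combination -e
  exact hx'.unique ((hasDerivAt_const x (-f (-a))).congr_of_eventuallyEq hev)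

/-- The graph of the Robin operator `H ψ = -ψ''` in `L²(-a, a)` with domain
`{ψ ∈ W^{2,2}(-a, a) : ψ'(±a) + c_± ψ(±a) = 0}`. Membership of `u` in `W^{2,2}(-a, a)` is
expressed by its continuously differentiable representative `f` (with derivative `f₁`), where `f₁`
is absolutely continuous with derivative `f₂ = u'' ∈ L²(-a, a)`; the second component `v` of the
pair is `-u''`. The boundary values are those of `f` and `f₁`. -/
def robinGraph (a : ℝ) (cp cm : ℂ) : Submodule ℂ (L2 a × L2 a) where
  carrier := {p | ∃ f f₁ f₂ : ℝ → ℂ,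
    p.1 =ᵐ[intervalMeasure a] f ∧ HasACDeriv a f f₁ ∧ HasACDeriv a f₁ f₂ ∧
    p.2 =ᵐ[intervalMeasure a] -f₂ ∧
    f₁ a + cp * f a = 0 ∧ f₁ (-a) + cm * f (-a) = 0}
  add_mem' := by
    rintro ⟨u, v⟩ ⟨u', v'⟩ ⟨f, f₁, f₂, hu, h1, h2, hv, bp, bm⟩
      ⟨g, g₁, g₂, hu', h1', h2', hv', bp', bm'⟩
    refine ⟨f + g, f₁ + g₁, f₂ + g₂, ?_, h1.add h1', h2.add h2', ?_, ?_, ?_⟩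
    · exact (Lp.coeFn_add u u').trans (hu.add hu')
    · rw [neg_add]
      exact (Lp.coeFn_add v v').trans (hv.add hv')
    · simp only [Pi.add_apply]
      linear_combination bp + bp'
    · simp only [Pi.add_apply]
      linear_combination bm + bm'
  zero_mem' := by
    refine ⟨0, 0, 0, Lp.coeFn_zero _ _ _, ?_, ?_, ?_, by simp, by simp⟩
    · exact ⟨intervalIntegrable_const (c := (0 : ℂ)), by simp⟩
    · exact ⟨intervalIntegrable_const (c := (0 : ℂ)), by simp⟩
    · simpa using Lp.coeFn_zero ℂ 2 (intervalMeasure a)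
  smul_mem' := by
    rintro c ⟨u, v⟩ ⟨f, f₁, f₂, hu, h1, h2, hv, bp, bm⟩
    refine ⟨c • f, c • f₁, c • f₂, ?_, h1.smul c, h2.smul c, ?_, ?_, ?_⟩
    · exact (Lp.coeFn_smul c u).trans (hu.const_smul c)
    · rw [← smul_neg]
      exact (Lp.coeFn_smul c v).trans (hv.const_smul c)
    · simp only [Pi.smul_apply, smul_eq_mul]
      linear_combination c * bp
    · simp only [Pi.smul_apply, smul_eq_mul]
      linear_combination c * bm

/-- The unbounded operator `H` in `L²(-a, a)` with parameters `c₊ = cp`, `c₋ = cm`. -/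
def robin (a : ℝ) (cp cm : ℂ) : L2 a →ₗ.[ℂ] L2 a := (robinGraph a cp cm).toLinearPMap

/-- `robinGraph` is the graph of a (single-valued) operator, namely of `robin`. -/
theorem robin_graph {a : ℝ} (ha : 0 < a) (cp cm : ℂ) :
    (robin a cp cm).graph = robinGraph a cp cm := by
  refine Submodule.toLinearPMap_graph_eq _ ?_
  rintro ⟨u, v⟩ ⟨f, f₁, f₂, hu, h1, h2, hv, -, -⟩ hu0
  simp only at hu0 hu hv ⊢
  subst hu0
  have hf : f =ᵐ[intervalMeasure a] 0 := hu.symm.trans (Lp.coeFn_zero _ _ _)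
  have hf₂ := h2.eq_zero ha (h1.eq_zero ha hf)
  refine (Lp.eq_zero_iff_ae_eq_zero).2 (hv.trans ?_)
  filter_upwards [hf₂] with x hx
  simp [hx]

section Spectral

variable {E : Type*} [AddCommGroup E] [Module ℂ E]

/-- `u` is an eigenvector of the unbounded operator `T` for the eigenvalue `z`. -/
def IsEigenvector (T : E →ₗ.[ℂ] E) (z : ℂ) (u : E) : Prop :=
  u ≠ 0 ∧ ∃ h : u ∈ T.domain, T ⟨u, h⟩ = z • u

/-- The set of eigenvalues of `T`. -/
def eigenvalues (T : E →ₗ.[ℂ] E) : Set ℂ := {z | ∃ u, IsEigenvector T z u}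

/-- `kerPow T z k` is the kernel of `(T - z)^k`: the space of those `u` for which `u`,
`(T - z) u`, …, `(T - z)^(k-1) u` lie in the domain of `T` and `(T - z)^k u = 0`. -/
def kerPow (T : E →ₗ.[ℂ] E) (z : ℂ) : ℕ → Submodule ℂ E
  | 0 => ⊥
  | k + 1 => ((kerPow T z k).comap (T.toFun - z • T.domain.subtype)).map T.domain.subtype

/-- The eigenvalue `z` of `T` is simple: its algebraic multiplicity, the dimension of the space
of all generalized eigenvectors, equals one. -/
def IsSimpleEigenvalue (T : E →ₗ.[ℂ] E) (z : ℂ) : Prop :=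
  Module.finrank ℂ (⨆ k, kerPow T z k : Submodule ℂ E) = 1

end Spectral

/-- The function `x ↦ a^{-1/2} (cos (l̄ (x + a)) - (c̄₋ / l̄) sin (l̄ (x + a)))`; for `l = 0` the
quotient `sin (l̄ (x + a)) / l̄` is read as its limit `x + a`. -/
def phiFun (a : ℝ) (cm l : ℂ) (x : ℝ) : ℂ :=
  (1 / (Real.sqrt a : ℂ)) *
    (Complex.cos (conj l * (x + a)) -
      conj cm * (if l = 0 then (x + a : ℂ) else Complex.sin (conj l * (x + a)) / conj l))

lemma continuous_phiFun (a : ℝ) (cm l : ℂ) : Continuous (phiFun a cm l) := by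
  unfold phiFun
  by_cases h : l = 0
  · simp only [h, if_true]
    fun_prop
  · simp only [h, if_false]
    fun_prop

lemma memLp_phiFun (a : ℝ) (cm l : ℂ) : MemLp (phiFun a cm l) 2 (intervalMeasure a) := by
  obtain ⟨C, hC⟩ := (isCompact_Icc (a := -a) (b := a)).exists_bound_of_continuousOn
    (continuous_phiFun a cm l).continuousOn
  refine MemLp.of_bound (continuous_phiFun a cm l).aestronglyMeasurable C ?_
  refine (ae_restrict_iff' measurableSet_Ioo).2 (Filter.Eventually.of_forall fun x hx => ?_)
  exact hC x (Set.Ioo_subset_Icc_self hx)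

/-- The function `phiFun` as an element of `L²(-a, a)`. -/
def phi (a : ℝ) (cm l : ℂ) : L2 a := (memLp_phiFun a cm l).toLp (phiFun a cm l)

/-- `T` is a Hilbert–Schmidt operator: `∑ ‖T b_i‖² < ∞` for every orthonormal (Hilbert) basis
`b`. Every Hilbert space has such a basis, and the sum does not depend on it. -/
def IsHilbertSchmidt {E : Type*} [NormedAddCommGroup E] [InnerProductSpace ℂ E]
    (T : E →L[ℂ] E) : Prop :=
  ∀ (w : Set E) (b : HilbertBasis w ℂ E), Summable fun i => ‖T (b i)‖ ^ 2

/-- `K` is the integral operator `(K u)(x) = ∫ k(x, y) u(y) dy` with a square-integrable kernel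
`k ∈ L²((-a, a) × (-a, a))`. -/
def IsIntegralOperatorWithKernel {a : ℝ} (K : L2 a →L[ℂ] L2 a) (k : ℝ × ℝ → ℂ) : Prop :=
  MemLp k 2 ((intervalMeasure a).prod (intervalMeasure a)) ∧
    ∀ u : L2 a, K u =ᵐ[intervalMeasure a] fun x => ∫ y, k (x, y) * u y ∂(intervalMeasure a)

end RobinLaplacian

end

open RobinLaplacian

noncomputable section

namespace RobinLaplacian

/-! ### Absolutely continuous functions -/

/-! The core is a perturbation principle, `exists_frame_operator`. Suppose all but finitely many
`φ_n` are matched bijectively with all but finitely many vectors of some orthonormal basis, with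
square-summable errors. Then Ω = V + L, where V*V - I has finite rank and L is Hilbert–Schmidt, so
Ω*Ω - I is Hilbert–Schmidt. On L² of a finite measure such an operator has a square-integrable
kernel (`IsHilbertSchmidt.exists_kernel`).

The comparison basis consists of the Neumann cosines cos(kπ(x+a)/(2a)), and the matching comes from
eigenvalue asymptotics. Up to conjugation and normalisation, `φ_n` is the solution `leftSol` of -ψ''
= l²ψ adapted to the condition at -a. So l² is an eigenvalue exactly when the condition at a also
holds, and Green's formula then makes `φ_n` an eigenvector of the adjoint.

Multiplied by -l, the condition at a reads (l² + c₊c₋) sin(2al) = (c₊ - c₋) l cos(2al). For large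
|l| the sine must be O(1/|l|), so l or -l lies within O(1/|l|) of some kπ/(2a) (`exists_freq_near`).
Two such zeros cannot share a frequency (`eq_of_secular_eq_zero`), and every large frequency has a
zero nearby (`exists_secular_eq_zero_near`). Hence `exists_matching`, with errors O(1/k). The
unmatched vectors on the two sides need not be counted or compared: they only contribute finite rank
terms. -/

lemma absolutelyContinuousOnInterval_primitive {g : ℝ → ℂ} {a b : ℝ}
    (h : IntervalIntegrable g volume a b) :
    AbsolutelyContinuousOnInterval (fun x => ∫ t in a..x, g t) a b := by
  have h0 := h.norm.absolutelyContinuousOnInterval_intervalIntegral (c := a) (by simp)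
  unfold AbsolutelyContinuousOnInterval at h0 ⊢
  -- Increments of the primitive of `g` are dominated by those of the primitive of `‖g‖`.
  refine squeeze_zero' (Filter.Eventually.of_forall fun _ => Finset.sum_nonneg fun i hi =>
    dist_nonneg) ?_ h0
  rw [Filter.eventually_inf_principal]
  filter_upwards with I hI
  refine Finset.sum_le_sum fun i hi => ?_
  have hm := hI.1 i hi
  have hsub : ∀ {y : ℝ}, y ∈ Set.uIcc a b → IntervalIntegrable g volume a y := fun hy =>
    h.mono_set (Set.uIcc_subset_uIcc_left hy)
  rw [dist_comm, dist_comm (∫ t in a..(I.2 i).1, ‖g t‖), Complex.dist_eq, Real.dist_eq,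
    intervalIntegral.integral_interval_sub_left (hsub hm.2) (hsub hm.1),
    intervalIntegral.integral_interval_sub_left (hsub hm.2).norm (hsub hm.1).norm]
  exact intervalIntegral.norm_integral_le_abs_integral_norm

lemma HasACDeriv.continuousOn {a : ℝ} (ha : 0 < a) {f g : ℝ → ℂ} (h : HasACDeriv a f g) :
    ContinuousOn f (Set.Icc (-a) a) := by
  have h1 := intervalIntegral.continuousOn_primitive_interval' h.1
    (Set.left_mem_uIcc (a := -a) (b := a))
  rw [Set.uIcc_of_le (by linarith)] at h1
  exact (continuousOn_const.add h1).congr fun x hx => h.2 x hx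

lemma HasACDeriv.of_hasDerivAt {a : ℝ} {f g : ℝ → ℂ} (h : ∀ x, HasDerivAt f (g x) x)
    (hg : Continuous g) : HasACDeriv a f g := by
  refine ⟨hg.intervalIntegrable _ _, fun x _ => ?_⟩
  rw [intervalIntegral.integral_eq_sub_of_hasDerivAt (fun y _ => h y)
    (hg.intervalIntegrable _ _)]
  ring

/-- The product rule for an absolutely continuous and a continuously differentiable function. -/
lemma HasACDeriv.mul {a : ℝ} (ha : 0 < a) {f g η η' : ℝ → ℂ} (h : HasACDeriv a f g)
    (hη : ∀ x, HasDerivAt η (η' x) x) (hη' : Continuous η') :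
    HasACDeriv a (fun x => f x * η x) (fun x => g x * η x + f x * η' x) := by
  have hle : -a ≤ a := by linarith
  have hηc : Continuous η := continuous_iff_continuousAt.2 fun x => (hη x).continuousAt
  have hI : Set.uIcc (-a) a = Set.Icc (-a) a := Set.uIcc_of_le hle
  have hint : IntervalIntegrable (fun x => g x * η x + f x * η' x) volume (-a) a := by
    refine (h.1.mul_continuousOn hηc.continuousOn).add ?_
    refine ContinuousOn.intervalIntegrable ?_
    rw [hI]
    exact (h.continuousOn ha).mul hη'.continuousOn
  refine ⟨hint, fun x hx => ?_⟩
  -- `f` is prescribed only on `[-a, a]`; `F` extends it, so that two-sided derivatives make sense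
  -- at the endpoints too.
  set F : ℝ → ℂ := fun x => f (-a) + ∫ t in (-a)..x, g t with hF
  have hFf : ∀ y ∈ Set.Icc (-a) a, f y = F y := h.2
  have hFac : AbsolutelyContinuousOnInterval F (-a) a := by
    have := (contDiff_const (c := f (-a)) (n := 1) (𝕜 := ℝ) (E := ℝ)).contDiffOn
      (s := Set.uIcc (-a) a) |>.absolutelyContinuousOnInterval
    exact this.add (absolutelyContinuousOnInterval_primitive h.1)
  have hηac : AbsolutelyContinuousOnInterval η (-a) a := by
    refine ContDiffOn.absolutelyContinuousOnInterval (ContDiff.contDiffOn ?_)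
    rw [contDiff_one_iff_deriv]
    refine ⟨fun x => (hη x).differentiableAt, ?_⟩
    rwa [show deriv η = η' from funext fun x => (hη x).deriv]
  -- The product minus the primitive of its expected derivative is absolutely continuous with zero
  -- derivative almost everywhere, hence constant.
  have hQac := (hFac.smul hηac).sub (absolutelyContinuousOnInterval_primitive hint)
  have hder : ∀ᵐ y, y ∈ Set.uIcc (-a) a → HasDerivAt
      (F • η - fun x => ∫ t in (-a)..x, (g t * η t + f t * η' t)) 0 y := by
    filter_upwards [h.1.ae_hasDerivAt_integral, hint.ae_hasDerivAt_integral] with y h1 h2 hy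
    have e1 := ((h1 hy (-a) Set.left_mem_uIcc).const_add (f (-a))).mul (hη y)
    have e2 := e1.sub (h2 hy (-a) Set.left_mem_uIcc)
    rw [hI] at hy
    refine e2.congr_deriv ?_
    have := hFf y hy
    simp only [hF] at this
    rw [this]
    ring
  obtain ⟨C, hC⟩ := hQac.const_of_ae_hasDerivAt_zero hder
  have c1 := hC (-a) Set.left_mem_uIcc
  have c2 := hC x (hI ▸ hx)
  simp only [Pi.sub_apply, Pi.mul_apply, smul_eq_mul, intervalIntegral.integral_same,
    sub_zero] at c1 c2
  rw [← hFf _ (Set.left_mem_Icc.2 hle)] at c1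
  rw [← hFf _ hx] at c2
  linear_combination c2 - c1

/-- Green's formula (Lagrange's identity) for `f ∈ W^{2,1}` and a twice continuously
differentiable function `η`. -/
lemma green_formula {a : ℝ} (ha : 0 < a) {f f₁ f₂ η η₁ η₂ : ℝ → ℂ} (h : HasACDeriv a f f₁)
    (h₁ : HasACDeriv a f₁ f₂) (hη : ∀ x, HasDerivAt η (η₁ x) x)
    (hη₁ : ∀ x, HasDerivAt η₁ (η₂ x) x) (hη₂ : Continuous η₂) :
    HasACDeriv a (fun x => f x * η₁ x - f₁ x * η x) (fun x => f x * η₂ x - f₂ x * η x) := by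
  have hη₁c : Continuous η₁ := continuous_iff_continuousAt.2 fun x => (hη₁ x).continuousAt
  have e := (h.mul ha hη₁ hη₂).add ((h₁.mul ha hη hη₁c).smul (-1))
  convert e using 1 <;> ext x <;> simp <;> ring

/-! ### The operator `H` -/

/-- The entire function `l ↦ sin (l x) / l`. -/
def sinQuot (l x : ℂ) : ℂ := if l = 0 then x else Complex.sin (l * x) / l

lemma hasDerivAt_sinQuot (l : ℂ) (c x : ℝ) :
    HasDerivAt (fun t : ℝ => sinQuot l ((t : ℂ) + c)) (Complex.cos (l * (x + c))) x := by
  have e : HasDerivAt (fun t : ℝ => ((t : ℂ) + c)) 1 x := by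
    simpa using (Complex.ofRealCLM.hasDerivAt (x := x)).add_const (c : ℂ)
  unfold sinQuot
  split_ifs with h
  · simpa [h] using e
  · exact (((Complex.hasDerivAt_sin _).comp x (e.const_mul l)).div_const l).congr_deriv (by field_simp)

lemma hasDerivAt_cos_shift (l : ℂ) (c x : ℝ) :
    HasDerivAt (fun t : ℝ => Complex.cos (l * (t + c))) (-l ^ 2 * sinQuot l (x + c)) x := by
  have e : HasDerivAt (fun t : ℝ => ((t : ℂ) + c)) 1 x := by
    simpa using (Complex.ofRealCLM.hasDerivAt (x := x)).add_const (c : ℂ)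
  refine ((Complex.hasDerivAt_cos _).comp x (e.const_mul l)).congr_deriv ?_
  unfold sinQuot
  split_ifs with h
  · simp [h]
  · field_simp

/-- The solution of `-ψ'' = l² ψ` with `ψ(-a) = 1` and `ψ'(-a) = -c₋`. -/
def leftSol (a : ℝ) (cm l : ℂ) (x : ℝ) : ℂ :=
  Complex.cos (l * (x + a)) - cm * sinQuot l (x + a)

/-- The derivative of `leftSol`. -/
def leftSolDeriv (a : ℝ) (cm l : ℂ) (x : ℝ) : ℂ :=
  -l ^ 2 * sinQuot l (x + a) - cm * Complex.cos (l * (x + a))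

lemma hasDerivAt_leftSol (a : ℝ) (cm l : ℂ) (x : ℝ) :
    HasDerivAt (leftSol a cm l) (leftSolDeriv a cm l x) x :=
  (hasDerivAt_cos_shift l a x).sub ((hasDerivAt_sinQuot l a x).const_mul cm)

lemma hasDerivAt_leftSolDeriv (a : ℝ) (cm l : ℂ) (x : ℝ) :
    HasDerivAt (leftSolDeriv a cm l) (-l ^ 2 * leftSol a cm l x) x := by
  refine (((hasDerivAt_sinQuot l a x).const_mul (-l ^ 2)).sub
    ((hasDerivAt_cos_shift l a x).const_mul cm)).congr_deriv ?_
  unfold leftSol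
  ring

lemma continuous_leftSol (a : ℝ) (cm l : ℂ) : Continuous (leftSol a cm l) :=
  continuous_iff_continuousAt.2 fun x => (hasDerivAt_leftSol a cm l x).continuousAt

@[simp] lemma leftSol_left (a : ℝ) (cm l : ℂ) : leftSol a cm l (-a) = 1 := by
  simp [leftSol, sinQuot]

@[simp] lemma leftSolDeriv_left (a : ℝ) (cm l : ℂ) : leftSolDeriv a cm l (-a) = -cm := by
  simp [leftSolDeriv, sinQuot]

/-- The conjugation cancels the antilinearity of the first slot: pairing with `phi` becomes
integration against the solution `leftSol` itself. -/
lemma phiFun_eq (a : ℝ) (cm l : ℂ) (x : ℝ) :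
    phiFun a cm l x = conj ((1 / (Real.sqrt a : ℂ)) * leftSol a cm l x) := by
  unfold phiFun leftSol sinQuot
  split_ifs with h <;> simp [h, ← Complex.cos_conj, ← Complex.sin_conj]

/-- The boundary functional at `a` applied to `leftSol`; its zeros are the square roots of the
eigenvalues. -/
def charFun (a : ℝ) (cp cm l : ℂ) : ℂ := leftSolDeriv a cm l a + cp * leftSol a cm l a

lemma integral_intervalMeasure {a : ℝ} (ha : 0 < a) (f : ℝ → ℂ) :
    ∫ x, f x ∂(intervalMeasure a) = ∫ x in (-a)..a, f x := by
  rw [intervalIntegral.integral_of_le (by linarith), integral_Ioc_eq_integral_Ioo]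

lemma ae_interval_iff {a : ℝ} (ha : 0 < a) {p : ℝ → Prop} (h : ∀ᵐ x ∂(intervalMeasure a), p x) :
    ∀ᵐ x, x ∈ Set.uIoc (-a) a → p x := by
  rw [Set.uIoc_of_le (by linarith), ← ae_restrict_iff' measurableSet_Ioc]
  rwa [← restrict_Ioo_eq_restrict_Ioc]

/-- Green's formula against a solution `η` of `-η'' = z η`. -/
lemma HasACDeriv.green {a : ℝ} (ha : 0 < a) {f f₁ f₂ η η₁ : ℝ → ℂ} {z : ℂ} (h : HasACDeriv a f f₁)
    (h₁ : HasACDeriv a f₁ f₂) (hη : ∀ x, HasDerivAt η (η₁ x) x)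
    (hη₁ : ∀ x, HasDerivAt η₁ (-z * η x) x) :
    HasACDeriv a (fun x => f x * η₁ x - f₁ x * η x) (fun x => -(f₂ x + z * f x) * η x) := by
  have hc : Continuous η := continuous_iff_continuousAt.2 fun x => (hη x).continuousAt
  convert green_formula ha h h₁ hη hη₁ (hc.const_mul (-z) |>.congr fun x => by simp) using 2
  ring

/-- Wronskian identity. -/
lemma HasACDeriv.wronskian_eq {a : ℝ} (ha : 0 < a) {f f₁ f₂ η η₁ : ℝ → ℂ} {z : ℂ}
    (h : HasACDeriv a f f₁)
    (h₁ : HasACDeriv a f₁ f₂) (hf : ∀ᵐ x ∂(intervalMeasure a), f₂ x = -z * f x)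
    (hη : ∀ x, HasDerivAt η (η₁ x) x) (hη₁ : ∀ x, HasDerivAt η₁ (-z * η x) x) {x : ℝ}
    (hx : x ∈ Set.Icc (-a) a) :
    f x * η₁ x - f₁ x * η x = f (-a) * η₁ (-a) - f₁ (-a) * η (-a) := by
  have e := (h.green ha h₁ hη hη₁).2 x hx
  have : ∫ t in (-a)..x, -(f₂ t + z * f t) * η t = 0 := by
    rw [← intervalIntegral.integral_zero (μ := volume) (a := -a) (b := x)]
    refine intervalIntegral.integral_congr_ae ?_
    filter_upwards [ae_interval_iff ha hf] with t ht hxt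
    rw [Set.uIoc_of_le hx.1] at hxt
    rw [ht (by rw [Set.uIoc_of_le (by linarith)]; exact Set.Ioc_subset_Ioc_right hx.2 hxt)]
    ring
  rw [this, add_zero] at e
  exact e

/-- The Wronskian of an eigenfunction `f` with `leftSol` vanishes at `-a`, where both satisfy the
same condition. It is constant, and at `a` it equals `f a * charFun a cp cm l`. -/
lemma charFun_eq_zero_of_mem_eigenvalues {a : ℝ} (ha : 0 < a) {cp cm l : ℂ}
    (hl : l ^ 2 ∈ eigenvalues (robin a cp cm)) : charFun a cp cm l = 0 := by
  obtain ⟨u, hu0, hu, hev⟩ := hl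
  have hg : (u, l ^ 2 • u) ∈ robinGraph a cp cm := by
    rw [← robin_graph ha, ← hev]
    exact (robin a cp cm).mem_graph ⟨u, hu⟩
  obtain ⟨f, f₁, f₂, huf, h, h₁, hv, bp, bm⟩ := hg
  have hf : ∀ᵐ x ∂(intervalMeasure a), f₂ x = -l ^ 2 * f x := by
    filter_upwards [huf, hv, Lp.coeFn_smul (l ^ 2) u] with x e1 e2 e3
    simp only [Pi.neg_apply, e3, Pi.smul_apply, smul_eq_mul, e1] at e2
    linear_combination e2
  have ham : a ∈ Set.Icc (-a) a := ⟨by linarith, le_rfl⟩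
  have w := h.wronskian_eq ha h₁ hf (hasDerivAt_leftSol a cm l) (hasDerivAt_leftSolDeriv a cm l) ham
  rw [leftSol_left, leftSolDeriv_left] at w
  have key : f a * charFun a cp cm l = 0 := by
    unfold charFun
    linear_combination w - bm + bp * leftSol a cm l a
  refine (mul_eq_zero.1 key).resolve_left fun hfa => hu0 ?_
  have hf₁a : f₁ a = 0 := by simpa [hfa] using bp
  refine Lp.eq_zero_iff_ae_eq_zero.2 (huf.trans ?_)
  refine (ae_restrict_iff' measurableSet_Ioo).2 (Filter.Eventually.of_forall fun x hx => ?_)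
  -- Uniqueness for zero Cauchy data at `a`: the Wronskian with the solution having value 0 and
  -- slope 1 at `x` equals `f x` at `x` and 0 at `a`.
  have w' := fun y hy => h.wronskian_eq ha h₁ hf (x := y)
    (η := fun t : ℝ => sinQuot l (t + ((-x : ℝ) : ℂ)))
    (fun t => hasDerivAt_sinQuot l (-x) t) (fun t => hasDerivAt_cos_shift l (-x) t) hy
  have wx := (w' x (Set.Ioo_subset_Icc_self hx)).trans (w' a ham).symm
  simpa [hfa, hf₁a, sinQuot] using wx

lemma memLp_of_continuous (a : ℝ) {f : ℝ → ℂ} (hf : Continuous f) :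
    MemLp f 2 (intervalMeasure a) := by
  obtain ⟨C, hC⟩ := (isCompact_Icc (a := -a) (b := a)).exists_bound_of_continuousOn hf.continuousOn
  refine MemLp.of_bound hf.aestronglyMeasurable C ?_
  refine (ae_restrict_iff' measurableSet_Ioo).2 (Filter.Eventually.of_forall fun x hx => ?_)
  exact hC x (Set.Ioo_subset_Icc_self hx)

lemma mem_eigenvalues_of_charFun_eq_zero {a : ℝ} (ha : 0 < a) {cp cm l : ℂ}
    (hl : charFun a cp cm l = 0) : l ^ 2 ∈ eigenvalues (robin a cp cm) := by
  have hle : -a ≤ a := by linarith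
  have hm := memLp_of_continuous a (continuous_leftSol a cm l)
  have hg : (hm.toLp, l ^ 2 • hm.toLp) ∈ robinGraph a cp cm := by
    have c1 : Continuous (leftSolDeriv a cm l) :=
      continuous_iff_continuousAt.2 fun x => (hasDerivAt_leftSolDeriv a cm l x).continuousAt
    refine ⟨leftSol a cm l, leftSolDeriv a cm l, fun x => -l ^ 2 * leftSol a cm l x, hm.coeFn_toLp,
      HasACDeriv.of_hasDerivAt (hasDerivAt_leftSol a cm l) c1,
      HasACDeriv.of_hasDerivAt (hasDerivAt_leftSolDeriv a cm l)
        (continuous_const.mul (continuous_leftSol a cm l)), ?_, hl, by simp⟩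
    filter_upwards [hm.coeFn_toLp, Lp.coeFn_smul (l ^ 2) hm.toLp] with x e1 e2
    simp [e2, e1]
  rw [← robin_graph ha, LinearPMap.mem_graph_iff] at hg
  obtain ⟨y, hy1, hy2⟩ := hg
  have hdom : hm.toLp ∈ (robin a cp cm).domain := by
    have := y.2
    rwa [hy1] at this
  refine ⟨hm.toLp, fun h0 => ?_, hdom, ?_⟩
  · have h0' : leftSol a cm l =ᵐ[intervalMeasure a] 0 :=
      hm.coeFn_toLp.symm.trans (Lp.eq_zero_iff_ae_eq_zero.1 h0)
    have := Measure.eqOn_open_of_ae_eq (μ := volume) (U := Set.Ioo (-a) a) h0'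
      isOpen_Ioo (continuous_leftSol a cm l).continuousOn continuousOn_const
    have := (this.closure (continuous_leftSol a cm l) continuous_const)
      (x := -a) (by rw [closure_Ioo (by linarith)]; exact Set.left_mem_Icc.2 hle)
    simp at this
  · refine Eq.trans ?_ hy2
    congr 1
    exact Subtype.ext hy1.symm

/-! ### Density of the domain and eigenvectors of the adjoint -/

lemma locallyIntegrableOn_L2 {a : ℝ} (u : L2 a) : LocallyIntegrableOn u (Set.Ioo (-a) a) volume := by
  have : IsFiniteMeasure (intervalMeasure a) := ⟨by simp⟩
  exact IntegrableOn.locallyIntegrableOn ((Lp.memLp u).integrable (by norm_num))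

/-- An element of `L²` that is orthogonal to all test functions vanishes. -/
lemma L2_eq_zero_of_forall_test {a : ℝ} (u : L2 a)
    (h : ∀ g : ℝ → ℝ, ContDiff ℝ (⊤ : ℕ∞) g → HasCompactSupport g → tsupport g ⊆ Set.Ioo (-a) a →
      ∫ x, (g x : ℂ) * u x ∂(intervalMeasure a) = 0) : u = 0 := by
  refine Lp.eq_zero_iff_ae_eq_zero.2 ((ae_restrict_iff' measurableSet_Ioo).2 ?_)
  refine isOpen_Ioo.ae_eq_zero_of_integral_contDiff_smul_eq_zero (locallyIntegrableOn_L2 u) ?_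
  intro g g1 g2 g3
  rw [← h g g1 g2 g3]
  symm
  simp only [Complex.real_smul]
  refine setIntegral_eq_integral_of_forall_compl_eq_zero fun x hx => ?_
  rw [image_eq_zero_of_notMem_tsupport fun h => hx (g3 h)]
  simp

/-- Test functions supported in the open interval satisfy any boundary condition at `±a`, so a
vector orthogonal to the domain vanishes. Density is what makes the adjoint single-valued. -/
lemma dense_robin_domain {a : ℝ} (ha : 0 < a) (cp cm : ℂ) :
    Dense ((robin a cp cm).domain : Set (L2 a)) := by
  rw [Submodule.dense_iff_topologicalClosure_eq_top, Submodule.topologicalClosure_eq_top_iff,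
    Submodule.eq_bot_iff]
  intro u hu
  refine L2_eq_zero_of_forall_test u fun g g1 g2 g3 => ?_
  have hb : ∀ f : ℝ → ℝ, Continuous f → Function.support f ⊆ tsupport g →
      MemLp (fun x => (f x : ℂ)) 2 (intervalMeasure a) := by
    intro f hf hs
    have hf' : Continuous fun x => (f x : ℂ) := by fun_prop
    refine (hf'.memLp_of_hasCompactSupport ?_).restrict _
    refine HasCompactSupport.of_support_subset_isCompact g2 fun x hx => hs ?_
    simpa using hx
  have d1 : ∀ x, HasDerivAt g (deriv g x) x := fun x =>
    (g1.differentiable (by simp) x).hasDerivAt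
  have g1' : ContDiff ℝ (⊤ : ℕ∞) (deriv g) := by
    have := (contDiff_infty_iff_deriv (𝕜 := ℝ)).1 g1
    exact this.2
  have d2 : ∀ x, HasDerivAt (deriv g) (deriv (deriv g) x) x := fun x =>
    (g1'.differentiable (by simp) x).hasDerivAt
  have c2 : Continuous (deriv (deriv g)) := ((contDiff_infty_iff_deriv (𝕜 := ℝ)).1 g1').2.continuous
  have m0 := hb g g1.continuous subset_closure
  have m2 := hb (fun x => -deriv (deriv g) x) c2.neg (by
    intro x hx
    have : x ∈ tsupport (deriv g) := support_deriv_subset (by simpa using hx)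
    exact closure_minimal support_deriv_subset (isClosed_tsupport g) this)
  have z0 : ∀ x, x ∉ Set.Ioo (-a) a → g x = 0 := fun x hx =>
    image_eq_zero_of_notMem_tsupport fun h => hx (g3 h)
  have z1 : ∀ x, x ∉ Set.Ioo (-a) a → deriv g x = 0 := fun x hx => by
    by_contra h
    exact hx (g3 (support_deriv_subset h))
  have hg : (m0.toLp, m2.toLp) ∈ robinGraph a cp cm := by
    refine ⟨fun x => (g x : ℂ), fun x => (deriv g x : ℝ), fun x => (deriv (deriv g) x : ℝ), m0.coeFn_toLp,
      HasACDeriv.of_hasDerivAt (fun x => (d1 x).ofReal_comp)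
        (Complex.continuous_ofReal.comp g1'.continuous),
      HasACDeriv.of_hasDerivAt (fun x => (d2 x).ofReal_comp) (Complex.continuous_ofReal.comp c2),
      ?_, by simp [z0, z1], by simp [z0, z1]⟩
    filter_upwards [m2.coeFn_toLp] with x hx
    exact hx.trans (by simp)
  rw [← robin_graph ha] at hg
  have := (Submodule.mem_orthogonal _ _).1 hu _ (LinearPMap.mem_domain_of_mem_graph hg)
  rw [L2.inner_def] at this
  rw [← this]
  refine integral_congr_ae ?_
  filter_upwards [m0.coeFn_toLp] with x hx
  rw [hx]
  simp [RCLike.inner_apply, mul_comm]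

lemma inner_phi {a : ℝ} (cm l : ℂ) (u : L2 a) : ⟪phi a cm l, u⟫_ℂ =
    ∫ x, (1 / (Real.sqrt a : ℂ)) * (leftSol a cm l x * u x) ∂(intervalMeasure a) := by
  rw [L2.inner_def]
  refine integral_congr_ae ?_
  filter_upwards [(memLp_phiFun a cm l).coeFn_toLp] with x hx
  unfold phi
  rw [hx, phiFun_eq]
  simp [RCLike.inner_apply]
  ring

lemma integrable_leftSol_mul {a : ℝ} (cm l : ℂ) (u : L2 a) : Integrable
    (fun x => (1 / (Real.sqrt a : ℂ)) * (leftSol a cm l x * u x)) (intervalMeasure a) := by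
  refine (L2.integrable_inner (phi a cm l) u (𝕜 := ℂ)).congr ?_
  filter_upwards [(memLp_phiFun a cm l).coeFn_toLp] with x hx
  unfold phi
  rw [hx, phiFun_eq]
  simp [RCLike.inner_apply]
  ring

/-- In Green's formula against `leftSol` the boundary term vanishes at `-a` by the choice of initial
data, and at `a` because of `hl`. -/
theorem isEigenvector_adjoint {a : ℝ} (ha : 0 < a) {cp cm l : ℂ} (hl : charFun a cp cm l = 0) :
    IsEigenvector (robin a cp cm)† (conj (l ^ 2)) (phi a cm l) := by
  have hle : -a ≤ a := by linarith
  have hform : ∀ x : (robin a cp cm).domain,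
      ⟪conj (l ^ 2) • phi a cm l, (x : L2 a)⟫_ℂ = ⟪phi a cm l, robin a cp cm x⟫_ℂ := by
    intro x
    have hg := (robin a cp cm).mem_graph x
    rw [robin_graph ha] at hg
    obtain ⟨f, f₁, f₂, huf, h, h₁, hv, bp, bm⟩ := hg
    rw [inner_smul_left, RingHomCompTriple.comp_apply, RingHom.id_apply, inner_phi, inner_phi,
      ← integral_const_mul]
    have e := h.green ha h₁ (hasDerivAt_leftSol a cm l) (hasDerivAt_leftSolDeriv a cm l)
    have e2 := e.2 a ⟨hle, le_rfl⟩
    simp only [leftSol_left, leftSolDeriv_left] at e2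
    have e3 : ∫ t in (-a)..a, -(f₂ t + l ^ 2 * f t) * leftSol a cm l t = 0 := by
      unfold charFun at hl
      linear_combination -e2 + bm - bp * leftSol a cm l a + f a * hl
    rw [← sub_eq_zero, ← integral_sub, ← mul_zero (-(1 / (Real.sqrt a : ℂ))), ← e3,
      ← integral_intervalMeasure ha, ← integral_const_mul]
    · refine integral_congr_ae ?_
      filter_upwards [huf, hv] with t h1 h2
      rw [h1, h2, Pi.neg_apply]
      ring
    · exact (integrable_leftSol_mul cm l _).const_mul _
    · exact integrable_leftSol_mul cm l _
  have hdom : phi a cm l ∈ (robin a cp cm)†.domain :=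
    LinearPMap.mem_adjoint_domain_of_exists _ ⟨_, hform⟩
  refine ⟨fun h0 => ?_, hdom, LinearPMap.adjoint_apply_eq (dense_robin_domain ha cp cm) _ hform⟩
  have h0' : phiFun a cm l =ᵐ[intervalMeasure a] 0 :=
    (memLp_phiFun a cm l).coeFn_toLp.symm.trans (Lp.eq_zero_iff_ae_eq_zero.1 h0)
  have := Measure.eqOn_open_of_ae_eq (μ := volume) (U := Set.Ioo (-a) a) h0'
    isOpen_Ioo (continuous_phiFun a cm l).continuousOn continuousOn_const
  have := (this.closure (continuous_phiFun a cm l) continuous_const)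
    (x := -a) (by rw [closure_Ioo (by linarith)]; exact Set.left_mem_Icc.2 hle)
  rw [phiFun_eq, leftSol_left] at this
  simp [ha.ne', Real.sqrt_eq_zero ha.le] at this

/-! ### Hilbert–Schmidt operators and Bessel sequences -/

section HilbertSchmidt

variable {E : Type*} [NormedAddCommGroup E] [InnerProductSpace ℂ E]

lemma hasSum_norm_inner_sq {ι : Type*} (b : HilbertBasis ι ℂ E) (x : E) :
    HasSum (fun i => ‖⟪b i, x⟫_ℂ‖ ^ 2) (‖x‖ ^ 2) := by
  rw [← Complex.hasSum_ofReal]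
  convert! b.hasSum_inner_mul_inner x x using 1
  · ext i
    rw [← inner_conj_symm x (b i), Complex.conj_mul', Complex.ofReal_pow]
  · rw [inner_self_eq_norm_sq_to_K]
    simp

/-- By Parseval both sums are the double sum of |⟨c_j, T b_i⟩|², taken in the two orders. Allowing
two different bases also yields independence of the basis, by passing to the adjoint twice. -/
lemma summable_norm_sq_adjoint [CompleteSpace E] {ι κ : Type*} (b : HilbertBasis ι ℂ E) (c : HilbertBasis κ ℂ E)
    {T : E →L[ℂ] E} (h : Summable fun i => ‖T (b i)‖ ^ 2) :
    Summable fun j => ‖ContinuousLinearMap.adjoint T (c j)‖ ^ 2 := by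
  have h1 : Summable fun p : ι × κ => ‖⟪c p.2, T (b p.1)⟫_ℂ‖ ^ 2 := by
    rw [summable_prod_of_nonneg fun p => sq_nonneg _]
    refine ⟨fun i => (hasSum_norm_inner_sq c (T (b i))).summable, h.congr fun i => ?_⟩
    exact (hasSum_norm_inner_sq c (T (b i))).tsum_eq.symm
  have h2 : Summable fun p : κ × ι => ‖⟪c p.1, T (b p.2)⟫_ℂ‖ ^ 2 := h1.prod_symm
  rw [summable_prod_of_nonneg fun p => sq_nonneg _] at h2
  refine h2.2.congr fun j => ?_
  rw [← (hasSum_norm_inner_sq b (ContinuousLinearMap.adjoint T (c j))).tsum_eq]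
  refine tsum_congr fun i => ?_
  rw [ContinuousLinearMap.adjoint_inner_right, norm_inner_symm]

namespace IsHilbertSchmidt

lemma of_basis [CompleteSpace E] {ι : Type*} (b : HilbertBasis ι ℂ E) {T : E →L[ℂ] E}
    (h : Summable fun i => ‖T (b i)‖ ^ 2) : IsHilbertSchmidt T := fun w c => by
  simpa using summable_norm_sq_adjoint b c (summable_norm_sq_adjoint b b h)

lemma adjoint [CompleteSpace E] {T : E →L[ℂ] E} (h : IsHilbertSchmidt T) :
    IsHilbertSchmidt (ContinuousLinearMap.adjoint T) := fun w b =>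
  summable_norm_sq_adjoint b b (h w b)

lemma add {S T : E →L[ℂ] E} (hS : IsHilbertSchmidt S) (hT : IsHilbertSchmidt T) :
    IsHilbertSchmidt (S + T) := fun w b => by
  refine Summable.of_nonneg_of_le (fun i => by positivity) (fun i => ?_)
    (((hS w b).add (hT w b)).mul_left 2)
  calc ‖(S + T) (b i)‖ ^ 2 ≤ (‖S (b i)‖ + ‖T (b i)‖) ^ 2 := by
        gcongr
        exact norm_add_le _ _
    _ ≤ 2 * (‖S (b i)‖ ^ 2 + ‖T (b i)‖ ^ 2) := by nlinarith [sq_nonneg (‖S (b i)‖ - ‖T (b i)‖)]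

lemma comp_left {T : E →L[ℂ] E} (hT : IsHilbertSchmidt T) (A : E →L[ℂ] E) :
    IsHilbertSchmidt (A ∘L T) := fun w b => by
  refine Summable.of_nonneg_of_le (fun i => by positivity) (fun i => ?_)
    ((hT w b).mul_left (‖A‖ ^ 2))
  rw [← mul_pow]
  gcongr
  exact A.le_opNorm _

lemma comp_right [CompleteSpace E] {T : E →L[ℂ] E} (hT : IsHilbertSchmidt T) (A : E →L[ℂ] E) :
    IsHilbertSchmidt (T ∘L A) := by
  simpa [ContinuousLinearMap.adjoint_comp] using
    (hT.adjoint.comp_left (ContinuousLinearMap.adjoint A)).adjoint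

end IsHilbertSchmidt

/-- The operator `∑ e_i ⟨φ_i, ·⟩` attached to a Bessel sequence `φ`. -/
lemma exists_analysis_operator {ι : Type*} (e : HilbertBasis ι ℂ E) (φ : ι → E) (B : ℝ)
    (hs : ∀ u, Summable fun i => ‖⟪φ i, u⟫_ℂ‖ ^ 2)
    (hB : ∀ u, ∑' i, ‖⟪φ i, u⟫_ℂ‖ ^ 2 ≤ B * ‖u‖ ^ 2) :
    ∃ T : E →L[ℂ] E, ∀ u, HasSum (fun i => ⟪φ i, u⟫_ℂ • e i) (T u) := by
  have hmem : ∀ u, Memℓp (fun i => ⟪φ i, u⟫_ℂ) 2 := fun u => by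
    refine memℓp_gen ?_
    simpa using hs u
  -- The coefficients form an ℓ² sequence, which the isometry `e.repr.symm` turns into a vector;
  -- this gives convergence and boundedness together.
  let f : E → lp (fun _ : ι => ℂ) 2 := fun u => ⟨fun i => ⟪φ i, u⟫_ℂ, hmem u⟩
  let T₀ : E →ₗ[ℂ] E :=
    { toFun := fun u => e.repr.symm (f u)
      map_add' := fun u v => by
        rw [← map_add]
        congr 1
        ext i
        exact inner_add_right _ _ _
      map_smul' := fun c u => by
        rw [RingHom.id_apply, ← map_smul]
        congr 1
        ext i
        exact inner_smul_right _ _ _ }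
  refine ⟨T₀.mkContinuous (Real.sqrt B) fun u => ?_, fun u => e.hasSum_repr_symm (f u)⟩
  change ‖e.repr.symm (f u)‖ ≤ _
  rw [LinearIsometryEquiv.norm_map]
  have h1 : ‖f u‖ ^ 2 = ∑' i, ‖⟪φ i, u⟫_ℂ‖ ^ 2 := by
    have := lp.norm_rpow_eq_tsum (p := 2) (by norm_num) (f u)
    simpa using this
  rw [← Real.sqrt_sq (norm_nonneg u), ← Real.sqrt_mul' _ (by positivity)]
  exact Real.le_sqrt_of_sq_le (h1 ▸ hB u)

/-- Pairing `T u` with `e i` extracts the coefficient ⟨φ_i, u⟩. Applying the adjoint termwise thus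
turns the series of Ω into that of Ω*Ω. -/
lemma adjoint_apply_basis [CompleteSpace E] {ι : Type*} {e : HilbertBasis ι ℂ E} {φ : ι → E} {T : E →L[ℂ] E}
    (hT : ∀ u, HasSum (fun i => ⟪φ i, u⟫_ℂ • e i) (T u)) (i : ι) :
    ContinuousLinearMap.adjoint T (e i) = φ i := by
  classical
  refine ext_inner_right ℂ fun u => ?_
  rw [ContinuousLinearMap.adjoint_inner_left]
  refine ((hT u).mapL (innerSL ℂ (e i))).unique ?_
  convert! hasSum_ite_eq i ⟪φ i, u⟫_ℂ using 2 with j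
  rw [innerSL_apply_apply, inner_smul_right, orthonormal_iff_ite.1 e.orthonormal]
  split_ifs with h1 h2 h2
  · simp [h2]
  · exact absurd h1.symm h2
  · exact absurd h2.symm h1
  · simp

/-- The operator `∑ e_i ⟨ψ_i, ·⟩` is Hilbert–Schmidt if `∑ ‖ψ_i‖² < ∞`. -/
lemma exists_hilbertSchmidt_operator [CompleteSpace E] {ι : Type*} (e : HilbertBasis ι ℂ E) (ψ : ι → E)
    (h : Summable fun i => ‖ψ i‖ ^ 2) :
    ∃ T : E →L[ℂ] E, (∀ u, HasSum (fun i => ⟪ψ i, u⟫_ℂ • e i) (T u)) ∧ IsHilbertSchmidt T := by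
  have hle : ∀ u i, ‖⟪ψ i, u⟫_ℂ‖ ^ 2 ≤ ‖ψ i‖ ^ 2 * ‖u‖ ^ 2 := fun u i => by
    rw [← mul_pow]
    gcongr
    exact norm_inner_le_norm _ _
  have hs : ∀ u, Summable fun i => ‖⟪ψ i, u⟫_ℂ‖ ^ 2 := fun u =>
    Summable.of_nonneg_of_le (fun i => by positivity) (hle u) (h.mul_right _)
  obtain ⟨T, hT⟩ := exists_analysis_operator e ψ (∑' i, ‖ψ i‖ ^ 2) hs fun u => by
    rw [← tsum_mul_right]
    exact (hs u).tsum_le_tsum (hle u) (h.mul_right _)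
  refine ⟨T, hT, ?_⟩
  have : IsHilbertSchmidt (ContinuousLinearMap.adjoint T) := .of_basis e <| by
    simpa only [adjoint_apply_basis hT] using h
  simpa using this.adjoint

/-- The operator `∑ e_i ⟨χ_i, ·⟩` for a sequence `χ` which enumerates, up to finitely many vectors,
an orthonormal basis and is zero otherwise, is unitary up to a finite rank operator. -/
lemma exists_partial_isometry [CompleteSpace E] {ι κ : Type*} (e : HilbertBasis ι ℂ E) (b : HilbertBasis κ ℂ E)
    (S : Set ι) (σ : ι → κ) (hσ : Set.InjOn σ S) (hfin : (σ '' S)ᶜ.Finite) :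
    ∃ V : E →L[ℂ] E, (∀ u, HasSum (fun i => ⟪S.indicator (fun n => b (σ n)) i, u⟫_ℂ • e i) (V u)) ∧
      IsHilbertSchmidt (ContinuousLinearMap.adjoint V ∘L V - ContinuousLinearMap.id ℂ E) := by
  classical
  set χ : ι → E := S.indicator fun n => b (σ n) with hχ
  -- Since `σ` is injective on `S`, this is a subsum of Parseval's sum for `b`, which gives the
  -- Bessel bound 1.
  have hsub : ∀ u, HasSum (fun i => ‖⟪χ i, u⟫_ℂ‖ ^ 2)
      (∑' i : S, ‖⟪b (σ i), u⟫_ℂ‖ ^ 2) := fun u => by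
    have hi : Function.Injective fun i : S => σ i := fun i j hij => Subtype.ext (hσ i.2 j.2 hij)
    have h1 := ((hasSum_norm_inner_sq b u).summable.comp_injective hi).hasSum
    have h2 := (hasSum_subtype_iff_indicator (f := fun i => ‖⟪b (σ i), u⟫_ℂ‖ ^ 2) (s := S)).1 h1
    refine h2.congr_fun fun i => ?_
    by_cases hi : i ∈ S <;> simp [hχ, hi]
  obtain ⟨V, hV⟩ := exists_analysis_operator e χ 1 (fun u => (hsub u).summable) fun u => by
    have hi : Function.Injective fun i : S => σ i := fun i j hij => Subtype.ext (hσ i.2 j.2 hij)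
    rw [(hsub u).tsum_eq, one_mul, ← (hasSum_norm_inner_sq b u).tsum_eq]
    exact ((hasSum_norm_inner_sq b u).summable.comp_injective hi).tsum_le_tsum_of_inj _ hi
      (fun _ _ => by positivity) (fun _ => le_rfl) (hasSum_norm_inner_sq b u).summable
  -- V*V fixes `b j` for every `j ∈ σ '' S`, so V*V - I kills all but finitely many basis vectors.
  refine ⟨V, hV, .of_basis b (summable_of_hasFiniteSupport (hfin.subset fun j hj => ?_))⟩
  rintro ⟨n, hn, rfl⟩
  refine hj ?_
  have hVb : V (b (σ n)) = e n := by
    refine (hV (b (σ n))).unique ?_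
    convert hasSum_ite_eq n (e n) using 2 with i
    by_cases hi : i ∈ S
    · rw [hχ, Set.indicator_of_mem hi, orthonormal_iff_ite.1 b.orthonormal]
      by_cases hin : i = n
      · simp [hin]
      · simp [hin, hσ.ne hi hn hin]
    · have : i ≠ n := fun h => hi (h ▸ hn)
      simp [hχ, hi, this]
  have : ContinuousLinearMap.adjoint V (e n) = b (σ n) := by
    rw [adjoint_apply_basis hV, hχ, Set.indicator_of_mem hn]
  simp [hVb, this]

/-- A sequence which is, up to finitely many vectors, quadratically close to an orthonormal basis
has a frame operator of the form identity plus Hilbert–Schmidt. -/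
theorem exists_frame_operator [CompleteSpace E] {ι κ : Type*} (e : HilbertBasis ι ℂ E) (b : HilbertBasis κ ℂ E)
    (φ : ι → E) (S : Set ι) (hS : Sᶜ.Finite) (σ : ι → κ) (hσ : Set.InjOn σ S)
    (hfin : (σ '' S)ᶜ.Finite) (hsum : Summable (S.indicator fun n => ‖φ n - b (σ n)‖ ^ 2)) :
    ∃ Ω Θ K : E →L[ℂ] E, (∀ u, HasSum (fun n => ⟪φ n, u⟫_ℂ • e n) (Ω u)) ∧
      Θ = ContinuousLinearMap.adjoint Ω ∘L Ω ∧
      (∀ u, HasSum (fun n => ⟪φ n, u⟫_ℂ • φ n) (Θ u)) ∧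
      Θ = ContinuousLinearMap.id ℂ E + K ∧ IsHilbertSchmidt K := by
  obtain ⟨V, hV, hVK⟩ := exists_partial_isometry e b S σ hσ hfin
  obtain ⟨L, hL, hLK⟩ := exists_hilbertSchmidt_operator e
    (fun i => φ i - S.indicator (fun n => b (σ n)) i) (by
      have h2 : Summable (Sᶜ.indicator fun n => ‖φ n‖ ^ 2) :=
        summable_of_hasFiniteSupport (hS.subset Set.support_indicator_subset)
      refine (hsum.add h2).congr fun i => ?_
      by_cases hi : i ∈ S <;> simp [hi])
  have hΩ : ∀ u, HasSum (fun n => ⟪φ n, u⟫_ℂ • e n) ((V + L) u) := fun u => by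
    refine ((hV u).add (hL u)).congr_fun fun i => ?_
    rw [← add_smul, ← inner_add_left]
    simp
  refine ⟨V + L, _, _, hΩ, rfl, fun u => ?_, (add_sub_cancel _ _).symm, ?_⟩
  · have := (hΩ u).mapL (ContinuousLinearMap.adjoint (V + L))
    simp only [map_smul, adjoint_apply_basis hΩ] at this
    exact this
  -- In this grouping every summand contains the finite rank defect of V or a Hilbert–Schmidt
  -- factor.
  · have : ContinuousLinearMap.adjoint (V + L) ∘L (V + L) - ContinuousLinearMap.id ℂ E =
        ((ContinuousLinearMap.adjoint V ∘L V - ContinuousLinearMap.id ℂ E) +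
          ContinuousLinearMap.adjoint V ∘L L) + ContinuousLinearMap.adjoint L ∘L (V + L) := by
      rw [map_add, ContinuousLinearMap.add_comp, ContinuousLinearMap.comp_add]
      abel
    rw [this]
    exact (hVK.add (hLK.comp_left _)).add (hLK.adjoint.comp_right _)

end HilbertSchmidt

/-! ### The kernel of a Hilbert–Schmidt operator on `L²` -/

section Kernel

variable {α : Type*} [MeasurableSpace α] {μ : Measure α}

lemma memLp_tensor [SFinite μ] (f g : Lp ℂ 2 μ) :
    MemLp (fun p : α × α => f p.1 * conj (g p.2)) 2 (μ.prod μ) := by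
  have hm : AEStronglyMeasurable (fun p : α × α => f p.1 * conj (g p.2)) (μ.prod μ) :=
    (Lp.aestronglyMeasurable f).comp_fst.mul
      (Complex.continuous_conj.comp_aestronglyMeasurable (Lp.aestronglyMeasurable g).comp_snd)
  rw [memLp_two_iff_integrable_sq_norm hm]
  have h : ∀ u : Lp ℂ 2 μ, Integrable (fun x => ‖u x‖ ^ 2) μ := fun u =>
    (memLp_two_iff_integrable_sq_norm (Lp.aestronglyMeasurable u)).1 (Lp.memLp u)
  refine ((h f).mul_prod (h g)).congr (Filter.Eventually.of_forall fun p => ?_)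
  simp [mul_pow]

/-- The function `(x, y) ↦ f(x) conj g(y)` as an element of `L²`. -/
def tensor [SFinite μ] (f g : Lp ℂ 2 μ) : Lp ℂ 2 (μ.prod μ) := (memLp_tensor f g).toLp

lemma coeFn_tensor [SFinite μ] (f g : Lp ℂ 2 μ) :
    tensor f g =ᵐ[μ.prod μ] fun p => f p.1 * conj (g p.2) := (memLp_tensor f g).coeFn_toLp

lemma inner_tensor [SFinite μ] (f g f' g' : Lp ℂ 2 μ) :
    ⟪tensor f g, tensor f' g'⟫_ℂ = ⟪f, f'⟫_ℂ * ⟪g', g⟫_ℂ := by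
  rw [L2.inner_def, L2.inner_def, L2.inner_def, ← integral_prod_mul]
  refine integral_congr_ae ?_
  filter_upwards [coeFn_tensor f g, coeFn_tensor f' g'] with p h1 h2
  rw [h1, h2]
  simp [RCLike.inner_apply]
  ring

/-- For a unit vector `g`, the map `f ↦ f ⊗ conj g` is an isometry. -/
def tensorRight [SFinite μ] (g : Lp ℂ 2 μ) (hg : ‖g‖ = 1) :
    Lp ℂ 2 μ →ₗᵢ[ℂ] Lp ℂ 2 (μ.prod μ) :=
  LinearMap.isometryOfInner
    { toFun := fun f => tensor f g
      map_add' := fun f f' => by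
        refine Lp.ext ?_
        have h := Measure.quasiMeasurePreserving_fst (μ := μ) (ν := μ) |>.ae (Lp.coeFn_add f f')
        filter_upwards [coeFn_tensor (f + f') g, coeFn_tensor f g, coeFn_tensor f' g,
          Lp.coeFn_add (tensor f g) (tensor f' g), h] with p h1 h2 h3 h4 h5
        rw [h1, h4, Pi.add_apply, h2, h3, h5, Pi.add_apply]
        ring
      map_smul' := fun c f => by
        refine Lp.ext ?_
        have h := Measure.quasiMeasurePreserving_fst (μ := μ) (ν := μ) |>.ae (Lp.coeFn_smul c f)
        filter_upwards [coeFn_tensor (c • f) g, coeFn_tensor f g,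
          Lp.coeFn_smul c (tensor f g), h] with p h1 h2 h3 h4
        rw [h1, RingHom.id_apply, h3, Pi.smul_apply, h2, h4, Pi.smul_apply, smul_eq_mul,
          smul_eq_mul]
        ring } fun f f' => by
    change ⟪tensor f g, tensor f' g⟫_ℂ = _
    rw [inner_tensor, inner_self_eq_norm_sq_to_K, hg]
    simp

/-- A Hilbert–Schmidt operator on `L²` of a finite measure is an integral operator with
square-integrable kernel. -/
theorem IsHilbertSchmidt.exists_kernel [IsFiniteMeasure μ] {K : Lp ℂ 2 μ →L[ℂ] Lp ℂ 2 μ}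
    (hK : IsHilbertSchmidt K) : ∃ k : α × α → ℂ, MemLp k 2 (μ.prod μ) ∧
      ∀ u : Lp ℂ 2 μ, K u =ᵐ[μ] fun x => ∫ y, k (x, y) * u y ∂μ := by
  obtain ⟨w, b, -⟩ := exists_hilbertBasis ℂ (Lp ℂ 2 μ)
  -- The kernel is the sum of the functions (K b_j)(x) conj(b_j(y)). They are mutually orthogonal
  -- with norms ‖K b_j‖, so the Hilbert–Schmidt condition is exactly convergence in L².
  have hof : OrthogonalFamily ℂ (fun _ : w => Lp ℂ 2 μ)
      fun j => tensorRight (b j) (b.orthonormal.1 j) := fun i j hij f g => by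
    change ⟪tensor f (b i), tensor g (b j)⟫_ℂ = 0
    rw [inner_tensor, b.orthonormal.2 hij.symm, mul_zero]
  have hsum : Summable fun j => tensor (K (b j)) (b j) :=
    (hof.summable_iff_norm_sq_summable fun j => K (b j)).2 (hK w b)
  set k : Lp ℂ 2 (μ.prod μ) := ∑' j, tensor (K (b j)) (b j) with hk
  have hinner : ∀ v u : Lp ℂ 2 μ, ⟪tensor v u, k⟫_ℂ = ⟪v, K u⟫_ℂ := fun v u => by
    have h1 := hsum.hasSum.mapL (innerSL ℂ (tensor v u))
    have h2 := ((b.hasSum_repr u).mapL K).mapL (innerSL ℂ v)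
    refine h1.unique (h2.congr_fun fun j => ?_)
    simp only [innerSL_apply_apply, inner_tensor, map_smul, b.repr_apply_apply]
    ring
  have hcoe : ∀ v u : Lp ℂ 2 μ, (fun p : α × α => ⟪tensor v u p, k p⟫_ℂ) =ᵐ[μ.prod μ]
      fun p => conj (v p.1) * (k p * u p.2) := fun v u => by
    filter_upwards [coeFn_tensor v u] with p hp
    rw [hp]
    simp [RCLike.inner_apply]
    ring
  refine ⟨k, Lp.memLp k, fun u => ?_⟩
  -- Pairing of `k` with 1 ⊗ conj u, which is in L² because the measure is finite.
  have hint : Integrable (fun p : α × α => k p * u p.2) (μ.prod μ) := by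
    have hone := indicatorConstLp_coeFn (p := 2) (μ := μ) (s := Set.univ) (hs := .univ)
      (hμs := measure_ne_top μ _) (c := (1 : ℂ))
    have h := Measure.quasiMeasurePreserving_fst (μ := μ) (ν := μ) |>.ae hone
    refine (L2.integrable_inner (𝕜 := ℂ)
      (tensor (indicatorConstLp 2 .univ (measure_ne_top μ _) (1 : ℂ)) u) k).congr ?_
    refine (hcoe _ u).trans ?_
    filter_upwards [h] with p hp
    rw [hp]
    simp
  -- Testing `hinner` on indicators `v = 1_s` identifies the integrals of both sides over every
  -- measurable set.
  refine Integrable.ae_eq_of_forall_setIntegral_eq _ _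
    ((Lp.memLp (K u)).integrable (by norm_num)) hint.integral_prod_left fun s hs _ => ?_
  have e := hinner (indicatorConstLp 2 hs (measure_ne_top μ s) (1 : ℂ)) u
  rw [L2.inner_indicatorConstLp_one] at e
  rw [← e, L2.inner_def, integral_congr_ae (hcoe _ u)]
  have hone := indicatorConstLp_coeFn (p := 2) (μ := μ) (hs := hs)
      (hμs := measure_ne_top μ s) (c := (1 : ℂ))
  have h := Measure.quasiMeasurePreserving_fst (μ := μ) (ν := μ) |>.ae hone
  have h' : (fun p : α × α => conj (indicatorConstLp 2 hs (measure_ne_top μ s) (1 : ℂ) p.1) *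
      (k p * u p.2)) =ᵐ[μ.prod μ] fun p => s.indicator 1 p.1 * (k p * u p.2) := by
    filter_upwards [h] with p hp
    rw [hp]
    by_cases hps : p.1 ∈ s <;> simp [hps]
  have hF : (fun p : α × α => s.indicator (1 : α → ℂ) p.1 * (k p * u p.2)) =
      (Prod.fst ⁻¹' s).indicator fun p => k p * u p.2 := by
    ext p
    by_cases hps : p.1 ∈ s <;> simp [hps]
  rw [integral_congr_ae h', integral_prod _ (by
    rw [hF]; exact hint.indicator (measurable_fst hs)), ← integral_indicator hs]
  refine integral_congr_ae (Filter.Eventually.of_forall fun x => ?_)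
  by_cases hx : x ∈ s <;> simp [hx]

end Kernel

/-! ### The orthonormal basis of cosines -/

/-- The frequencies of the Neumann Laplacian. -/
def freq (a : ℝ) (k : ℤ) : ℝ := k * Real.pi / (2 * a)

lemma integral_cos_freq {a : ℝ} (ha : 0 < a) (k : ℤ) :
    ∫ x in (-a)..a, Real.cos (freq a k * (x + a)) = if k = 0 then 2 * a else 0 := by
  split_ifs with h
  · simp [h, freq]
    ring
  · have hk : (k : ℝ) ≠ 0 := by exact_mod_cast h
    have hω : freq a k ≠ 0 := by
      unfold freq
      have := Real.pi_ne_zero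
      positivity
    have hd : ∀ x ∈ Set.uIcc (-a) a, HasDerivAt (fun x => Real.sin (freq a k * (x + a)) / freq a k)
        (Real.cos (freq a k * (x + a))) x := fun x _ => by
      have := ((((hasDerivAt_id x).add_const a).const_mul (freq a k)).sin).div_const (freq a k)
      refine this.congr_deriv ?_
      simp only [id]
      field_simp
    rw [intervalIntegral.integral_eq_sub_of_hasDerivAt hd
      (Continuous.intervalIntegrable (by fun_prop) _ _)]
    have : freq a k * (a + a) = k * Real.pi := by
      unfold freq
      field_simp
      ring
    simp [this, Real.sin_int_mul_pi]

/-- The normalisation constants of the cosine basis. -/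
def cosNorm (a : ℝ) (k : ℕ) : ℝ := if k = 0 then 1 / Real.sqrt (2 * a) else 1 / Real.sqrt a

/-- The normalised eigenfunctions of the Neumann Laplacian. -/
def cosFun (a : ℝ) (k : ℕ) (x : ℝ) : ℂ := (cosNorm a k * Real.cos (freq a k * (x + a)) : ℝ)

lemma continuous_cosFun (a : ℝ) (k : ℕ) : Continuous (cosFun a k) := by
  unfold cosFun
  fun_prop

/-- The functions `cosFun` as elements of `L²`. -/
def cosVec (a : ℝ) (k : ℕ) : L2 a := (memLp_of_continuous a (continuous_cosFun a k)).toLp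

lemma coeFn_cosVec (a : ℝ) (k : ℕ) : cosVec a k =ᵐ[intervalMeasure a] cosFun a k :=
  (memLp_of_continuous a (continuous_cosFun a k)).coeFn_toLp

/-- The product-to-sum formula leaves the frequencies j - k and j + k. The second vanishes only for
j = k = 0, which is why `cosNorm` is exceptional at 0. -/
lemma orthonormal_cosVec {a : ℝ} (ha : 0 < a) : Orthonormal ℂ (cosVec a) := by
  rw [orthonormal_iff_ite]
  intro j k
  have h1 : ⟪cosVec a j, cosVec a k⟫_ℂ = ((cosNorm a j * cosNorm a k / 2 *
      ((if (j : ℤ) - k = 0 then 2 * a else 0) + if (j : ℤ) + k = 0 then 2 * a else 0) : ℝ) : ℂ) := by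
    rw [← integral_cos_freq ha, ← integral_cos_freq ha, ← intervalIntegral.integral_add
      (Continuous.intervalIntegrable (by fun_prop) _ _)
      (Continuous.intervalIntegrable (by fun_prop) _ _), ← intervalIntegral.integral_const_mul,
      ← intervalIntegral.integral_ofReal, ← integral_intervalMeasure ha, L2.inner_def]
    refine integral_congr_ae ?_
    filter_upwards [coeFn_cosVec a j, coeFn_cosVec a k] with x hj hk
    rw [hj, hk, cosFun, cosFun, RCLike.inner_apply, Complex.conj_ofReal, ← Complex.ofReal_mul]
    congr 1
    have e1 : freq a ((j : ℤ) - k) * (x + a) = freq a j * (x + a) - freq a k * (x + a) := by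
      unfold freq
      push_cast
      ring
    have e2 : freq a ((j : ℤ) + k) * (x + a) = freq a j * (x + a) + freq a k * (x + a) := by
      unfold freq
      push_cast
      ring
    rw [e1, e2, Real.cos_sub, Real.cos_add]
    ring
  rw [h1]
  by_cases hjk : j = k
  · subst hjk
    by_cases h0 : j = 0
    · have : Real.sqrt (2 * a) * Real.sqrt (2 * a) = 2 * a := Real.mul_self_sqrt (by linarith)
      have hs : Real.sqrt (2 * a) ≠ 0 := (Real.sqrt_pos.2 (by linarith)).ne'
      simp only [h0, cosNorm, if_true, Nat.cast_zero, sub_zero, add_zero]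
      norm_cast
      field_simp
      nlinarith
    · have : Real.sqrt a * Real.sqrt a = a := Real.mul_self_sqrt ha.le
      have hs : Real.sqrt a ≠ 0 := (Real.sqrt_pos.2 ha).ne'
      have h2 : (j : ℤ) + j ≠ 0 := by omega
      simp only [cosNorm, if_neg h0, if_neg h2, sub_self, if_true, add_zero]
      norm_cast
      field_simp
      nlinarith
  · rw [if_neg (by omega), if_neg (by omega), if_neg hjk]
    simp

lemma integrable_mul_L2 {a : ℝ} {g : ℝ → ℝ} (hg : Continuous g) (u : L2 a) :
    Integrable (fun x => (g x : ℂ) * u x) (intervalMeasure a) := by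
  have h := memLp_of_continuous a (Complex.continuous_ofReal.comp hg)
  refine (L2.integrable_inner (𝕜 := ℂ) h.toLp u).congr ?_
  filter_upwards [h.coeFn_toLp] with x hx
  rw [hx]
  simp [RCLike.inner_apply, mul_comm]

/-- Induction by 2 cos θ cos kθ = cos (k+1)θ + cos (k-1)θ. The index runs over the integers because
k - 1 may become negative. -/
lemma integral_cos_pow_mul_cos {a : ℝ} (u : L2 a)
    (h : ∀ k : ℕ, ∫ x, (Real.cos (freq a k * (x + a)) : ℂ) * u x ∂(intervalMeasure a) = 0)
    (m : ℕ) : ∀ k : ℤ, ∫ x, ((Real.cos (freq a 1 * (x + a)) ^ m *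
      Real.cos (freq a k * (x + a)) : ℝ) : ℂ) * u x ∂(intervalMeasure a) = 0 := by
  induction m with
  | zero =>
    intro k
    obtain ⟨n, rfl | rfl⟩ := k.eq_nat_or_neg
    · simpa using h n
    · have : ∀ x, freq a (-(n : ℤ)) * (x + a) = -(freq a n * (x + a)) := fun x => by
        unfold freq
        push_cast
        ring
      simpa [this] using h n
  | succ m ih =>
    intro k
    have e := congrArg₂ (· + ·) (ih (k + 1)) (ih (k - 1))
    rw [← integral_add (integrable_mul_L2 (by fun_prop) u) (integrable_mul_L2 (by fun_prop) u)] at e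
    rw [← mul_zero (1 / 2 : ℂ), ← add_zero (0 : ℂ), ← e, ← integral_const_mul]
    congr 1
    ext x
    have e1 : freq a (k + 1) * (x + a) = freq a k * (x + a) + freq a 1 * (x + a) := by
      unfold freq
      push_cast
      ring
    have e2 : freq a (k - 1) * (x + a) = freq a k * (x + a) - freq a 1 * (x + a) := by
      unfold freq
      push_cast
      ring
    rw [e1, e2, Real.cos_sub, Real.cos_add]
    push_cast
    ring

/-- The map x ↦ cos(π(x+a)/(2a)) is a homeomorphism of [-a, a] onto [-1, 1], so by Weierstrass its
polynomials approximate every test function uniformly. -/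
lemma L2_eq_zero_of_integral_cos {a : ℝ} (ha : 0 < a) (u : L2 a)
    (h : ∀ k : ℕ, ∫ x, (Real.cos (freq a k * (x + a)) : ℂ) * u x ∂(intervalMeasure a) = 0) :
    u = 0 := by
  have hpow : ∀ m : ℕ, ∫ x, ((Real.cos (freq a 1 * (x + a)) ^ m : ℝ) : ℂ) * u x
      ∂(intervalMeasure a) = 0 := fun m => by
    simpa [freq] using integral_cos_pow_mul_cos u h m 0
  have hpoly : ∀ p : Polynomial ℝ, ∫ x, ((p.eval (Real.cos (freq a 1 * (x + a))) : ℝ) : ℂ) * u x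
      ∂(intervalMeasure a) = 0 := fun p => by
    induction p using Polynomial.induction_on' with
    | add p q hp hq =>
      simp only [Polynomial.eval_add, Complex.ofReal_add, add_mul]
      rw [integral_add (integrable_mul_L2 (by fun_prop) u) (integrable_mul_L2 (by fun_prop) u),
        hp, hq, add_zero]
    | monomial n c =>
      simp only [Polynomial.eval_monomial, Complex.ofReal_mul, mul_assoc]
      rw [integral_const_mul, hpow, mul_zero]
  refine L2_eq_zero_of_forall_test u fun g g1 _ _ => ?_
  have hg := g1.continuous
  have : IsFiniteMeasure (intervalMeasure a) := ⟨by simp⟩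
  have hu : Integrable u (intervalMeasure a) := (Lp.memLp u).integrable (by norm_num)
  set M := ∫ x, ‖u x‖ ∂(intervalMeasure a) with hM
  have hM0 : 0 ≤ M := integral_nonneg fun x => norm_nonneg _
  refine norm_le_zero_iff.1 (le_of_forall_pos_le_add fun δ hδ => ?_)
  -- The test function is expressed through the inverse substitution; `M + 1` avoids dividing by
  -- zero when `u = 0`.
  obtain ⟨p, hp⟩ := exists_polynomial_near_of_continuousOn (-1) 1
    (fun t => g (2 * a / Real.pi * Real.arccos t - a))
    (by fun_prop) (δ / (M + 1)) (by positivity)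
  rw [zero_add, ← sub_zero (∫ x, (g x : ℂ) * u x ∂(intervalMeasure a)), ← hpoly p,
    ← integral_sub (integrable_mul_L2 hg u) (integrable_mul_L2 (by fun_prop) u)]
  calc _ ≤ ∫ x, δ / (M + 1) * ‖u x‖ ∂(intervalMeasure a) := by
        refine norm_integral_le_of_norm_le (hu.norm.const_mul _) ?_
        refine (ae_restrict_iff' measurableSet_Ioo).2 (Filter.Eventually.of_forall fun x hx => ?_)
        have h1 := hp (Real.cos (freq a 1 * (x + a))) ⟨Real.neg_one_le_cos _, Real.cos_le_one _⟩
        have h2 : Real.arccos (Real.cos (freq a 1 * (x + a))) = freq a 1 * (x + a) := by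
          have hx1 : 0 ≤ x + a := by linarith [hx.1]
          have hx2 : x + a ≤ 2 * a := by linarith [hx.2]
          refine Real.arccos_cos ?_ ?_
          · unfold freq
            positivity
          · unfold freq
            rw [div_mul_eq_mul_div, div_le_iff₀ (by positivity)]
            push_cast
            nlinarith [Real.pi_pos]
        have h3 : 2 * a / Real.pi * (freq a 1 * (x + a)) - a = x := by
          unfold freq
          field_simp
          push_cast
          ring
        simp only [h2, h3] at h1
        rw [← sub_mul, norm_mul, ← Complex.ofReal_sub, Complex.norm_real, Real.norm_eq_abs,
          abs_sub_comm]
        gcongr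
    _ = δ * (M / (M + 1)) := by
        rw [integral_const_mul, ← hM]
        ring
    _ ≤ δ * 1 := by
        gcongr
        rw [div_le_one (by positivity)]
        linarith
    _ = δ := mul_one δ

/-- The orthonormal basis of cosines of `L²(-a, a)`. -/
def cosBasis {a : ℝ} (ha : 0 < a) : HilbertBasis ℕ ℂ (L2 a) :=
  HilbertBasis.mkOfOrthogonalEqBot (orthonormal_cosVec ha) <| by
    rw [Submodule.eq_bot_iff]
    refine fun u hu => L2_eq_zero_of_integral_cos ha u fun k => ?_
    have h := (Submodule.mem_orthogonal _ _).1 hu _ (Submodule.subset_span ⟨k, rfl⟩)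
    have hN : (cosNorm a k : ℂ) ≠ 0 := by
      have h1 := Real.sqrt_pos.2 ha
      have h2 := Real.sqrt_pos.2 (by linarith : 0 < 2 * a)
      norm_cast
      unfold cosNorm
      split_ifs <;> positivity
    refine (mul_eq_zero.1 ?_).resolve_left hN
    rw [← h, L2.inner_def, ← integral_const_mul]
    refine integral_congr_ae ?_
    filter_upwards [coeFn_cosVec a k] with x hx
    rw [hx, cosFun, RCLike.inner_apply, Complex.conj_ofReal]
    push_cast
    ring

lemma coe_cosBasis {a : ℝ} (ha : 0 < a) : ⇑(cosBasis ha) = cosVec a :=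
  HilbertBasis.coe_mkOfOrthogonalEqBot _ _

/-! ### Asymptotics of the eigenvalues -/

lemma norm_sub_one_cos_le {t : ℂ} (ht : ‖t‖ ≤ 1) : ‖Complex.cos t - 1‖ ≤ 2 * ‖t‖ := by
  have h1 : ‖Complex.exp (t * Complex.I) - 1‖ ≤ 2 * ‖t * Complex.I‖ :=
    Complex.norm_exp_sub_one_le (by simpa using ht)
  have h2 : ‖Complex.exp (-t * Complex.I) - 1‖ ≤ 2 * ‖-t * Complex.I‖ :=
    Complex.norm_exp_sub_one_le (by simpa using ht)
  have e : Complex.cos t - 1 =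
      ((Complex.exp (t * Complex.I) - 1) + (Complex.exp (-t * Complex.I) - 1)) / 2 := by
    rw [Complex.cos]
    ring
  simp only [norm_mul, norm_neg, Complex.norm_I, mul_one] at h1 h2
  rw [e, norm_div, Complex.norm_ofNat]
  have := norm_add_le (Complex.exp (t * Complex.I) - 1) (Complex.exp (-t * Complex.I) - 1)
  linarith

lemma norm_sin_le_two_mul {t : ℂ} (ht : ‖t‖ ≤ 1) : ‖Complex.sin t‖ ≤ 2 * ‖t‖ := by
  have h1 : ‖Complex.exp (t * Complex.I) - 1‖ ≤ 2 * ‖t * Complex.I‖ :=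
    Complex.norm_exp_sub_one_le (by simpa using ht)
  have h2 : ‖Complex.exp (-t * Complex.I) - 1‖ ≤ 2 * ‖-t * Complex.I‖ :=
    Complex.norm_exp_sub_one_le (by simpa using ht)
  have e : Complex.sin t =
      ((Complex.exp (-t * Complex.I) - 1) - (Complex.exp (t * Complex.I) - 1)) * Complex.I / 2 := by
    rw [Complex.sin]
    ring
  simp only [norm_mul, norm_neg, Complex.norm_I, mul_one] at h1 h2
  rw [e, norm_div, Complex.norm_ofNat, norm_mul, Complex.norm_I, mul_one]
  have := norm_sub_le (Complex.exp (-t * Complex.I) - 1) (Complex.exp (t * Complex.I) - 1)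
  linarith

lemma norm_cos_le_three {t : ℂ} (ht : ‖t‖ ≤ 1) : ‖Complex.cos t‖ ≤ 3 := by
  have h := norm_sub_one_cos_le ht
  have h2 := norm_add_le (Complex.cos t - 1) 1
  rw [sub_add_cancel, norm_one] at h2
  linarith

/-- A lower bound for the sine near its zero at the origin. -/
lemma norm_le_three_mul_norm_sin {t : ℂ} (ht : |t.re| ≤ Real.pi / 2) :
    ‖t‖ ≤ 3 * ‖Complex.sin t‖ := by
  have hre : (Complex.sin t).re = Real.sin t.re * Real.cosh t.im := by
    conv_lhs => rw [Complex.sin_eq]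
    simp [Complex.sin_ofReal_re, Complex.cos_ofReal_re, Complex.sinh_ofReal_re]
  have him : (Complex.sin t).im = Real.cos t.re * Real.sinh t.im := by
    conv_lhs => rw [Complex.sin_eq]
    simp [Complex.sin_ofReal_re, Complex.cos_ofReal_re, Complex.sinh_ofReal_re]
  -- The two squares are treated separately: Jordan's inequality with π ≤ 4 bounds |Re t| by 2|sin
  -- t|, and |y| ≤ |sinh y| bounds |Im t| by |sin t|; together the factor is 3.
  have hsq : ‖Complex.sin t‖ ^ 2 = Real.sin t.re ^ 2 + Real.sinh t.im ^ 2 := by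
    rw [Complex.sq_norm, Complex.normSq_apply, hre, him]
    have h1 := Real.cosh_sq t.im
    have h2 := Real.sin_sq_add_cos_sq t.re
    linear_combination Real.sin t.re ^ 2 * h1 + Real.sinh t.im ^ 2 * h2
  have h1 : |t.re| ≤ 2 * ‖Complex.sin t‖ := by
    have h := Real.mul_abs_le_abs_sin ht
    have h' : |Real.sin t.re| ≤ ‖Complex.sin t‖ :=
      abs_le_of_sq_le_sq (by nlinarith [sq_nonneg (Real.sinh t.im)]) (norm_nonneg _)
    have hp : 1 / 2 ≤ 2 / Real.pi := by
      rw [div_le_div_iff₀ (by norm_num) Real.pi_pos]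
      linarith [Real.pi_le_four]
    nlinarith [abs_nonneg t.re]
  have h2 : |t.im| ≤ ‖Complex.sin t‖ := by
    have h : |t.im| ≤ |Real.sinh t.im| := by
      rw [Real.abs_sinh, Real.self_le_sinh_iff]
      exact abs_nonneg _
    have h' : |Real.sinh t.im| ≤ ‖Complex.sin t‖ :=
      abs_le_of_sq_le_sq (by nlinarith [sq_nonneg (Real.sin t.re)]) (norm_nonneg _)
    linarith
  linarith [Complex.norm_le_abs_re_add_abs_im t]

lemma norm_sin_add_int_mul_pi (t : ℂ) (k : ℤ) :
    ‖Complex.sin (t + k * Real.pi)‖ = ‖Complex.sin t‖ := by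
  rw [Complex.sin_antiperiodic.add_int_mul_eq]
  simp

lemma norm_cos_add_int_mul_pi (t : ℂ) (k : ℤ) :
    ‖Complex.cos (t + k * Real.pi)‖ = ‖Complex.cos t‖ := by
  rw [Complex.cos_antiperiodic.add_int_mul_eq]
  simp

lemma exists_int_norm_sub_mul_pi_le (w : ℂ) :
    ∃ k : ℤ, ‖w - k * Real.pi‖ ≤ 3 * ‖Complex.sin w‖ := by
  refine ⟨round (w.re / Real.pi), ?_⟩
  set k := round (w.re / Real.pi)
  have h : ‖Complex.sin w‖ = ‖Complex.sin (w - k * Real.pi)‖ := by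
    rw [← norm_sin_add_int_mul_pi (w - k * Real.pi) k, sub_add_cancel]
  rw [h]
  refine norm_le_three_mul_norm_sin ?_
  have h1 := abs_sub_round (w.re / Real.pi)
  have h2 : (w - k * Real.pi).re = (w.re / Real.pi - k) * Real.pi := by
    have := Real.pi_ne_zero
    simp
    field_simp
  rw [h2, abs_mul, abs_of_pos Real.pi_pos]
  nlinarith [Real.pi_pos]

/-! ### Location and separation of the large zeros of the secular function -/

/-- The entire function `-l * charFun l`. -/
def secular (a : ℝ) (cp cm l : ℂ) : ℂ :=
  (l ^ 2 + cp * cm) * Complex.sin (l * (a + a)) - (cp - cm) * l * Complex.cos (l * (a + a))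

lemma secular_eq (a : ℝ) (cp cm l : ℂ) : secular a cp cm l = -l * charFun a cp cm l := by
  have h : Complex.sin (l * (a + a)) = l * sinQuot l (a + a) := by
    unfold sinQuot
    split_ifs with h
    · simp [h]
    · field_simp
  unfold secular charFun leftSol leftSolDeriv
  rw [h]
  ring

lemma secular_neg (a : ℝ) (cp cm l : ℂ) : secular a cp cm (-l) = - secular a cp cm l := by
  unfold secular
  rw [neg_mul, Complex.sin_neg, Complex.cos_neg]
  ring

/-- A radius beyond which the leading term of `secular` dominates. -/
def domRadius (cp cm : ℂ) : ℝ := 1 + 4 * ‖cp - cm‖ + 2 * ‖cp * cm‖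

lemma norm_sq_add_ge {cp cm l : ℂ} (hl : domRadius cp cm ≤ ‖l‖) :
    ‖l‖ ^ 2 / 2 ≤ ‖l ^ 2 + cp * cm‖ := by
  have h := norm_sub_le (l ^ 2 + cp * cm) (cp * cm)
  rw [add_sub_cancel_right, norm_pow] at h
  unfold domRadius at hl
  nlinarith [norm_nonneg (cp - cm), norm_nonneg (cp * cm)]

/-- At a zero the sine is O(1/|l|) times the cosine, and sin² + cos² = 1 then bounds the cosine. No
prior bound on Im l is needed. -/
lemma norm_cos_sin_le_of_secular_eq_zero {a : ℝ} {cp cm l : ℂ} (h : secular a cp cm l = 0)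
    (hl : domRadius cp cm ≤ ‖l‖) : ‖Complex.cos (l * (a + a))‖ ≤ 2 ∧
      ‖l‖ * ‖Complex.sin (l * (a + a))‖ ≤ 4 * ‖cp - cm‖ := by
  have hge := norm_sq_add_ge hl
  unfold domRadius at hl
  set S := Complex.sin (l * (a + a)) with hS
  set C := Complex.cos (l * (a + a)) with hC
  have h0 := norm_nonneg (cp - cm)
  have h1 := norm_nonneg (cp * cm)
  have hl1 : 1 ≤ ‖l‖ := by linarith
  have e : ‖l ^ 2 + cp * cm‖ * ‖S‖ = ‖cp - cm‖ * ‖l‖ * ‖C‖ := by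
    rw [← norm_mul, ← norm_mul, ← norm_mul]
    congr 1
    unfold secular at h
    linear_combination h
  have e1 : ‖l‖ * ‖S‖ ≤ 2 * ‖cp - cm‖ * ‖C‖ := by
    have : ‖l‖ * (‖l‖ * ‖S‖) ≤ ‖l‖ * (2 * ‖cp - cm‖ * ‖C‖) := by
      nlinarith [norm_nonneg S]
    exact le_of_mul_le_mul_left this (by linarith)
  have e2 : ‖S‖ ≤ ‖C‖ / 2 := by
    have : ‖l‖ * ‖S‖ ≤ ‖l‖ * (‖C‖ / 2) := by nlinarith [norm_nonneg C]
    exact le_of_mul_le_mul_left this (by linarith)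
  have e3 : ‖C‖ ^ 2 ≤ 1 + ‖S‖ ^ 2 := by
    have : C ^ 2 = 1 - S ^ 2 := by
      rw [hS, hC]
      linear_combination Complex.sin_sq_add_cos_sq (l * (a + a))
    rw [← norm_pow, this, ← norm_pow]
    exact (norm_sub_le (1 : ℂ) (S ^ 2)).trans_eq (by rw [norm_one])
  have e4 : ‖C‖ ≤ 2 := by nlinarith [norm_nonneg C, norm_nonneg S]
  exact ⟨e4, e1.trans (by nlinarith)⟩

lemma norm_sub_freq (a : ℝ) (ha : 0 < a) (l : ℂ) (k : ℤ) :
    ‖l * (a + a) - k * Real.pi‖ = 2 * a * ‖l - freq a k‖ := by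
  have : l * (a + a) - k * Real.pi = ((2 * a : ℝ) : ℂ) * (l - freq a k) := by
    have : (a : ℂ) ≠ 0 := by exact_mod_cast ha.ne'
    unfold freq
    push_cast
    field_simp
    ring
  rw [this, norm_mul, Complex.norm_real, Real.norm_of_nonneg (by linarith)]

/-- Large zeros of `secular` are, up to sign, close to the Neumann frequencies. -/
lemma exists_freq_near {a : ℝ} (ha : 0 < a) {cp cm l : ℂ} (h : secular a cp cm l = 0)
    (hl : domRadius cp cm ≤ ‖l‖) : ∃ (k : ℕ) (s : ℂ), (s = l ∨ s = -l) ∧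
      ‖s - freq a k‖ ≤ 6 * ‖cp - cm‖ / a / ‖l‖ := by
  obtain ⟨k, hk⟩ := exists_int_norm_sub_mul_pi_le (l * (a + a))
  have hl0 : 0 < ‖l‖ := by
    unfold domRadius at hl
    linarith [norm_nonneg (cp - cm), norm_nonneg (cp * cm)]
  have h1 := (norm_cos_sin_le_of_secular_eq_zero h hl).2
  rw [norm_sub_freq a ha] at hk
  have h2 : ‖l - freq a k‖ ≤ 6 * ‖cp - cm‖ / a / ‖l‖ := by
    rw [le_div_iff₀ hl0, le_div_iff₀ ha]
    nlinarith [norm_nonneg l]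
  -- A negative index is made natural by passing from `l` to `-l`.
  obtain ⟨n, rfl | rfl⟩ := k.eq_nat_or_neg
  · exact ⟨n, l, .inl rfl, h2⟩
  · refine ⟨n, -l, .inr rfl, ?_⟩
    have : -l - freq a n = -(l - freq a (-(n : ℤ))) := by
      unfold freq
      push_cast
      ring
    rwa [this, norm_neg]

/-- Large zeros of `secular` are uniformly separated. -/
lemma eq_of_secular_eq_zero {a : ℝ} (ha : 0 < a) {cp cm l l' : ℂ} (h : secular a cp cm l = 0)
    (h' : secular a cp cm l' = 0) (hl : domRadius cp cm ≤ ‖l‖) (hl' : domRadius cp cm ≤ ‖l'‖)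
    (hR : 48 * ‖cp - cm‖ + a ≤ a * ‖l‖) (hdist : 2 * a * ‖l - l'‖ ≤ 1) : l = l' := by
  by_contra hne
  have hpos : 0 < ‖l - l'‖ := norm_pos_iff.2 (sub_ne_zero.2 hne)
  have hC := (norm_cos_sin_le_of_secular_eq_zero h hl).1
  have hC' := (norm_cos_sin_le_of_secular_eq_zero h' hl').1
  have hg := norm_sq_add_ge hl
  have hg' := norm_sq_add_ge hl'
  have hp : ‖cp * cm‖ ≤ ‖l‖ * ‖l'‖ := by
    unfold domRadius at hl hl'
    nlinarith [norm_nonneg (cp - cm), norm_nonneg (cp * cm)]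
  have hl1 : 1 ≤ ‖l‖ ∧ 1 ≤ ‖l'‖ := by
    unfold domRadius at hl hl'
    constructor <;> linarith [norm_nonneg (cp - cm), norm_nonneg (cp * cm)]
  -- Combining the two equations through the addition formula produces a factor `l' - l` on the
  -- right. As |sin| is comparable to |l - l'| on the left, a nonzero difference cancels and bounds
  -- |l|, against `hR`.
  have key : (l ^ 2 + cp * cm) * (l' ^ 2 + cp * cm) * Complex.sin ((l - l') * (a + a)) =
      (cp - cm) * (l' - l) * (l * l' - cp * cm) * Complex.cos (l * (a + a)) *
        Complex.cos (l' * (a + a)) := by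
    rw [sub_mul, Complex.sin_sub]
    unfold secular at h h'
    linear_combination (l' ^ 2 + cp * cm) * Complex.cos (l' * (a + a)) * h -
      (l ^ 2 + cp * cm) * Complex.cos (l * (a + a)) * h'
  have hn : ‖(l - l') * (a + a)‖ = 2 * a * ‖l - l'‖ := by
    simpa [freq] using norm_sub_freq a ha (l - l') 0
  have hs : 2 * a * ‖l - l'‖ ≤ 3 * ‖Complex.sin ((l - l') * (a + a))‖ := by
    rw [← hn]
    refine norm_le_three_mul_norm_sin ((Complex.abs_re_le_norm _).trans ?_)
    rw [hn]
    linarith [Real.pi_gt_three]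
  have hnum : ‖l * l' - cp * cm‖ ≤ 2 * (‖l‖ * ‖l'‖) := by
    have := norm_sub_le (l * l') (cp * cm)
    rw [norm_mul] at this
    linarith
  set S := ‖Complex.sin ((l - l') * (a + a))‖
  have hkey := congrArg norm key
  simp only [norm_mul] at hkey
  rw [norm_sub_rev l' l] at hkey
  have hL : (‖l‖ ^ 2 / 2) * (‖l'‖ ^ 2 / 2) * S ≤
      ‖cp - cm‖ * ‖l - l'‖ * (2 * (‖l‖ * ‖l'‖)) * 2 * 2 := by
    calc _ ≤ ‖l ^ 2 + cp * cm‖ * ‖l' ^ 2 + cp * cm‖ * S := by gcongr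
      _ ≤ _ := by
        rw [hkey]
        gcongr
  have hL2 : ‖l‖ * ‖l'‖ * S ≤ 32 * ‖cp - cm‖ * ‖l - l'‖ := by
    have hpp : 0 < ‖l‖ * ‖l'‖ := by nlinarith
    refine le_of_mul_le_mul_left (a := ‖l‖ * ‖l'‖) ?_ hpp
    linarith
  have hL3 : ‖l‖ * S ≤ 32 * ‖cp - cm‖ * ‖l - l'‖ := by
    refine le_trans ?_ hL2
    have : 0 ≤ S := norm_nonneg _
    nlinarith [mul_nonneg (norm_nonneg l) this]
  have h1 : a * ‖l‖ * ‖l - l'‖ ≤ 48 * ‖cp - cm‖ * ‖l - l'‖ := by nlinarith [norm_nonneg l]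
  nlinarith

lemma norm_secular_freq {a : ℝ} (ha : 0 < a) (cp cm : ℂ) (k : ℤ) :
    ‖secular a cp cm (freq a k)‖ = ‖cp - cm‖ * |freq a k| := by
  have hft : (freq a k : ℂ) * (a + a) = 0 + k * Real.pi := by
    have := norm_sub_freq a ha (freq a k) k
    rw [sub_self, norm_zero, mul_zero, norm_eq_zero, sub_eq_zero] at this
    rw [this, zero_add]
  have hs : Complex.sin ((freq a k : ℂ) * (a + a)) = 0 := by
    rw [← norm_eq_zero, hft, norm_sin_add_int_mul_pi]
    simp
  have hc : ‖Complex.cos ((freq a k : ℂ) * (a + a))‖ = 1 := by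
    rw [hft, norm_cos_add_int_mul_pi]
    simp
  unfold secular
  rw [hs, mul_zero, zero_sub, norm_neg, norm_mul, norm_mul, hc, Complex.norm_real, mul_one,
    Real.norm_eq_abs]

lemma differentiable_secular (a : ℝ) (cp cm : ℂ) : Differentiable ℂ (secular a cp cm) := by
  unfold secular
  fun_prop

/-- Lower bound for the oscillation of `secular` on a circle around a Neumann frequency. -/
lemma le_norm_secular_sub {a : ℝ} (ha : 0 < a) {cp cm : ℂ} {k : ℤ}
    (h1 : 2 * domRadius cp cm ≤ freq a k) (h2 : 1 / a ≤ freq a k) {z : ℂ}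
    (hz : ‖z - freq a k‖ = 1 / (2 * a)) :
    freq a k ^ 2 / 24 - 7 * ‖cp - cm‖ * freq a k ≤
      ‖secular a cp cm z - secular a cp cm (freq a k)‖ := by
  have hρ : 1 / (2 * a) = (1 / a) / 2 := by field_simp
  have hf0 : 0 < freq a k := lt_of_lt_of_le (by positivity) h2
  have hfn : ‖(freq a k : ℂ)‖ = freq a k := by rw [Complex.norm_real, Real.norm_of_nonneg hf0.le]
  have hz1 : freq a k / 2 ≤ ‖z‖ := by
    have := norm_sub_norm_le (freq a k : ℂ) z
    rw [norm_sub_rev, hz, hfn] at this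
    linarith
  have hz2 : ‖z‖ ≤ 2 * freq a k := by
    have := norm_sub_norm_le z (freq a k : ℂ)
    rw [hz, hfn] at this
    linarith
  -- The radius is chosen so that |t| = 1, whence |sin| ≥ 1/3 and |cos| ≤ 3. With freq/2 ≤ |z| ≤ 2
  -- freq this gives 1/24 = (1/8)(1/3) and 7 = 6 + 1.
  set t := z * (a + a) - k * Real.pi with ht
  have htn : ‖t‖ = 1 := by
    rw [ht, norm_sub_freq a ha, hz]
    field_simp
  have hzt : z * (a + a) = t + k * Real.pi := by rw [ht, sub_add_cancel]
  have hsin : 1 / 3 ≤ ‖Complex.sin (z * (a + a))‖ := by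
    rw [hzt, norm_sin_add_int_mul_pi]
    have := norm_le_three_mul_norm_sin (t := t)
      ((Complex.abs_re_le_norm _).trans (by rw [htn]; linarith [Real.pi_gt_three]))
    linarith
  have hcos : ‖Complex.cos (z * (a + a))‖ ≤ 3 := by
    rw [hzt, norm_cos_add_int_mul_pi]
    exact norm_cos_le_three htn.le
  have hGf : ‖secular a cp cm (freq a k)‖ ≤ ‖cp - cm‖ * freq a k := by
    rw [norm_secular_freq ha, abs_of_pos hf0]
  have hA : freq a k ^ 2 / 24 ≤ ‖(z ^ 2 + cp * cm) * Complex.sin (z * (a + a))‖ := by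
    rw [norm_mul]
    have := norm_sq_add_ge (cp := cp) (cm := cm) (l := z) (by linarith)
    have h8 : freq a k ^ 2 / 8 ≤ ‖z ^ 2 + cp * cm‖ := le_trans (by nlinarith) this
    calc freq a k ^ 2 / 24 = freq a k ^ 2 / 8 * (1 / 3) := by ring
      _ ≤ _ := by gcongr
  have hB : ‖(cp - cm) * z * Complex.cos (z * (a + a))‖ ≤ ‖cp - cm‖ * (2 * freq a k) * 3 := by
    rw [norm_mul, norm_mul]
    gcongr
  have h3 := norm_sub_norm_le ((z ^ 2 + cp * cm) * Complex.sin (z * (a + a)))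
    ((cp - cm) * z * Complex.cos (z * (a + a)))
  have h4 := norm_sub_norm_le (secular a cp cm z) (secular a cp cm (freq a k))
  have h5 : secular a cp cm z = (z ^ 2 + cp * cm) * Complex.sin (z * (a + a)) -
    (cp - cm) * z * Complex.cos (z * (a + a)) := rfl
  rw [← h5] at h3
  linarith

/-- Near each large Neumann frequency there is a zero of `secular`. -/
lemma exists_secular_eq_zero_near {a : ℝ} (ha : 0 < a) {cp cm : ℂ} {k : ℤ}
    (h1 : 2 * domRadius cp cm ≤ freq a k) (h2 : 1 / a ≤ freq a k)
    (h3 : 240 * ‖cp - cm‖ ≤ freq a k) :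
    (∃ z, secular a cp cm z ≠ 0) ∧
      ∃ z, secular a cp cm z = 0 ∧ ‖z - freq a k‖ ≤ 1 / (2 * a) := by
  have hf0 : 0 < freq a k := lt_of_lt_of_le (by positivity) h2
  set ε := freq a k ^ 2 / 24 - 7 * ‖cp - cm‖ * freq a k with hε
  have hε0 : 2 * (‖cp - cm‖ * freq a k) < ε := by
    rw [hε]
    nlinarith [norm_nonneg (cp - cm)]
  have hcf : 0 ≤ ‖cp - cm‖ * freq a k := by positivity
  have hr : 0 < 1 / (2 * a) := by positivity
  have hsph : ∀ z ∈ Metric.sphere (freq a k : ℂ) (1 / (2 * a)),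
      ε ≤ ‖secular a cp cm z - secular a cp cm (freq a k)‖ := fun z hz =>
    le_norm_secular_sub ha h1 h2 (by rwa [mem_sphere_iff_norm] at hz)
  obtain ⟨z₁, hz₁⟩ := (NormedSpace.sphere_nonempty (x := (freq a k : ℂ))).2 hr.le
  have hne : secular a cp cm z₁ ≠ secular a cp cm (freq a k) := fun h => by
    have := hsph z₁ hz₁
    rw [h, sub_self, norm_zero] at this
    linarith
  have hd := differentiable_secular a cp cm
  have han : AnalyticOnNhd ℂ (secular a cp cm) Set.univ := fun z _ => hd.analyticAt z
  refine ⟨?_, ?_⟩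
  · by_contra! h
    exact hne ((h _).trans (h _).symm)
  · have hfreq : ∃ᶠ z in nhds (freq a k : ℂ),
        secular a cp cm z ≠ secular a cp cm (freq a k) := fun h => by
      have := han.eq_of_eventuallyEq (analyticOnNhd_const (v := secular a cp cm (freq a k)))
        (z₀ := (freq a k : ℂ)) (h.mono fun z hz => not_not.1 hz)
      exact hne (congrFun this z₁)
    -- Quantitative open mapping: on the circle the oscillation is quadratic in the frequency, while
    -- the value at the centre is only linear. Hence 0 lies in the ball of radius `ε / 2` covered by
    -- the image.
    have hsub := hd.diffContOnCl.ball_subset_image_closedBall hr hsph hfreq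
    have h0 : (0 : ℂ) ∈ Metric.ball (secular a cp cm (freq a k)) (ε / 2) := by
      rw [mem_ball_iff_norm, zero_sub, norm_neg]
      rw [norm_secular_freq ha, abs_of_pos hf0]
      linarith
    obtain ⟨z, hz, hz0⟩ := hsub h0
    exact ⟨z, hz0, by rwa [mem_closedBall_iff_norm] at hz⟩

lemma finite_secular_zeros {a : ℝ} {cp cm : ℂ} (h : ∃ z, secular a cp cm z ≠ 0) (R : ℝ) :
    {z | secular a cp cm z = 0 ∧ ‖z‖ ≤ R}.Finite := by
  obtain ⟨z₁, hz₁⟩ := h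
  have han : AnalyticOnNhd ℂ (secular a cp cm) Set.univ := fun z _ =>
    (differentiable_secular a cp cm).analyticAt z
  have hev := (han.eqOn_zero_or_eventually_ne_zero_of_preconnected isPreconnected_univ).resolve_left
    fun h => hz₁ (h (Set.mem_univ _))
  have := (isCompact_closedBall (0 : ℂ) R).finite_sdiff_of_mem_codiscreteWithin
    (Filter.codiscreteWithin_mono (Set.subset_univ _) hev)
  refine this.subset fun z hz => ⟨by simpa using hz.2, fun h => h hz.1⟩

/-! ### Comparison of the eigenfunctions with the cosine basis -/

lemma phi_neg (a : ℝ) (cm l : ℂ) : phi a cm (-l) = phi a cm l := by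
  have h : phiFun a cm (-l) = phiFun a cm l := by
    ext x
    unfold phiFun
    by_cases hl : l = 0 <;> simp [hl]
  unfold phi
  simp only [h]

/-- The argument differs from the real number `f * (x + a)` by some t with |t| ≤ 2a|l - f| ≤ 1. The
addition formulas bound the cosine error by 4|t| and the sine by 3 + 2 = 5. -/
lemma norm_leftSol_sub_cos_le {a : ℝ} (cm : ℂ) {l : ℂ} {f x : ℝ} (hl : l ≠ 0)
    (hf : 2 * a * ‖l - f‖ ≤ 1) (hx : x ∈ Set.Ioo (-a) a) :
    ‖leftSol a cm l x - Real.cos (f * (x + a))‖ ≤ 8 * a * ‖l - f‖ + 5 * ‖cm‖ / ‖l‖ := by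
  have hy0 : 0 ≤ x + a := by linarith [hx.1]
  have hy1 : x + a ≤ 2 * a := by linarith [hx.2]
  set t : ℂ := (l - f) * ((x + a : ℝ) : ℂ) with ht
  have htn : ‖t‖ ≤ 2 * a * ‖l - f‖ := by
    rw [ht, norm_mul, Complex.norm_real, Real.norm_of_nonneg hy0]
    nlinarith [norm_nonneg (l - f)]
  have ht1 : ‖t‖ ≤ 1 := htn.trans hf
  have e : l * (x + a) = ((f * (x + a) : ℝ) : ℂ) + t := by
    rw [ht]
    push_cast
    ring
  have hc : ‖Complex.cos ((f * (x + a) : ℝ) : ℂ)‖ ≤ 1 := by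
    rw [← Complex.ofReal_cos, Complex.norm_real]
    exact Real.abs_cos_le_one _
  have hs : ‖Complex.sin ((f * (x + a) : ℝ) : ℂ)‖ ≤ 1 := by
    rw [← Complex.ofReal_sin, Complex.norm_real]
    exact Real.abs_sin_le_one _
  have h1 := norm_sub_one_cos_le ht1
  have h2 := norm_sin_le_two_mul ht1
  have h3 := norm_cos_le_three ht1
  have hcos : ‖Complex.cos (l * (x + a)) - Complex.cos ((f * (x + a) : ℝ) : ℂ)‖ ≤ 4 * ‖t‖ := by
    have : Complex.cos (l * (x + a)) - Complex.cos ((f * (x + a) : ℝ) : ℂ) =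
        Complex.cos ((f * (x + a) : ℝ) : ℂ) * (Complex.cos t - 1) -
          Complex.sin ((f * (x + a) : ℝ) : ℂ) * Complex.sin t := by
      rw [e, Complex.cos_add]
      ring
    rw [this]
    refine (norm_sub_le _ _).trans ?_
    rw [norm_mul, norm_mul]
    nlinarith [norm_nonneg (Complex.cos t - 1), norm_nonneg (Complex.sin t)]
  have hsin : ‖Complex.sin (l * (x + a))‖ ≤ 5 := by
    rw [e, Complex.sin_add]
    refine (norm_add_le _ _).trans ?_
    rw [norm_mul, norm_mul]
    nlinarith [norm_nonneg (Complex.cos t), norm_nonneg (Complex.sin t)]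
  have hsplit : leftSol a cm l x - Real.cos (f * (x + a)) =
      (Complex.cos (l * (x + a)) - Complex.cos ((f * (x + a) : ℝ) : ℂ)) -
        cm * (Complex.sin (l * (x + a)) / l) := by
    rw [leftSol, sinQuot, if_neg hl, Complex.ofReal_cos]
    ring
  rw [hsplit]
  refine (norm_sub_le _ _).trans (add_le_add (by linarith) ?_)
  rw [norm_mul, norm_div, ← mul_div_assoc]
  have hl0 := norm_pos_iff.2 hl
  rw [mul_comm (5 : ℝ)]
  gcongr

lemma exists_norm_phi_sub_cosVec_le {a : ℝ} (ha : 0 < a) (cm : ℂ) (M : ℝ) : ∃ C, 0 ≤ C ∧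
    ∀ (l : ℂ) (k : ℕ), k ≠ 0 → l ≠ 0 → 2 * a * ‖l - freq a k‖ ≤ 1 → ‖l - freq a k‖ ≤ M / ‖l‖ →
      ‖phi a cm l - cosVec a k‖ ≤ C / ‖l‖ := by
  have : IsFiniteMeasure (intervalMeasure a) := ⟨by simp⟩
  have hs := Real.sqrt_pos.2 ha
  refine ⟨(measureUnivNNReal (intervalMeasure a) : ℝ) ^ (2 : ENNReal).toReal⁻¹ *
    (1 / Real.sqrt a * (8 * a * |M| + 5 * ‖cm‖)), by positivity, fun l k hk hl h1 h2 => ?_⟩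
  have hl0 := norm_pos_iff.2 hl
  rw [mul_div_assoc, mul_div_assoc]
  refine Lp.norm_le_of_ae_bound (by positivity) ?_
  have hmem : ∀ᵐ x ∂(intervalMeasure a), x ∈ Set.Ioo (-a) a := ae_restrict_mem measurableSet_Ioo
  filter_upwards [Lp.coeFn_sub (phi a cm l) (cosVec a k), (memLp_phiFun a cm l).coeFn_toLp,
    coeFn_cosVec a k, hmem] with x e1 e2 e3 hx
  have e : phiFun a cm l x - cosFun a k x =
      conj ((1 / (Real.sqrt a : ℂ)) * (leftSol a cm l x - Real.cos (freq a k * (x + a)))) := by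
    rw [phiFun_eq, cosFun, cosNorm, if_neg hk, mul_sub, map_sub]
    congr 1
    rw [← Complex.ofReal_one, ← Complex.ofReal_div, ← Complex.ofReal_mul, Complex.conj_ofReal]
  rw [e1, Pi.sub_apply, e3]
  change ‖(memLp_phiFun a cm l).toLp (phiFun a cm l) x - _‖ ≤ _
  rw [e2, e, RCLike.norm_conj, norm_mul, norm_div, norm_one, Complex.norm_real,
    Real.norm_of_nonneg hs.le]
  gcongr
  refine (norm_leftSol_sub_cos_le cm hl h1 hx).trans ?_
  rw [add_div, mul_div_assoc (8 * a)]
  gcongr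
  exact h2.trans (by gcongr; exact le_abs_self M)

lemma eq_of_norm_freq_sub_lt {a : ℝ} (ha : 0 < a) {j k : ℤ}
    (h : ‖(freq a j : ℂ) - freq a k‖ ≤ 1 / a) : j = k := by
  have e : freq a j - freq a k = ((j - k : ℤ) : ℝ) * (Real.pi / (2 * a)) := by
    unfold freq
    push_cast
    ring
  rw [← Complex.ofReal_sub, Complex.norm_real, Real.norm_eq_abs, e, abs_mul,
    abs_of_pos (by have := Real.pi_pos; positivity : 0 < Real.pi / (2 * a))] at h
  by_contra hne
  have h1 : (1 : ℝ) ≤ |((j - k : ℤ) : ℝ)| := by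
    exact_mod_cast Int.one_le_abs (sub_ne_zero.2 hne)
  have h2 : 1 / a < Real.pi / (2 * a) := by
    rw [div_lt_div_iff₀ ha (by positivity)]
    nlinarith [Real.pi_gt_three]
  have : 0 < 1 / a := by positivity
  nlinarith

lemma exists_le_freq {a : ℝ} (ha : 0 < a) (B : ℝ) : ∃ N : ℕ, ∀ k : ℕ, N ≤ k → B ≤ freq a k := by
  obtain ⟨N, hN⟩ := exists_nat_ge (2 * a * B)
  refine ⟨N, fun k hk => ?_⟩
  have hk' : (N : ℝ) ≤ k := by exact_mod_cast hk
  unfold freq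
  rw [le_div_iff₀ (by positivity)]
  push_cast
  nlinarith [Real.pi_gt_three, (Nat.cast_nonneg k : (0 : ℝ) ≤ k)]

/-- All but finitely many `φ_n` are matched bijectively with all but finitely many elements of the
cosine basis, with an error of the order of the inverse index. -/
lemma exists_matching {a : ℝ} (ha : 0 < a) {cp cm : ℂ} {l : ℕ → ℂ}
    (hinj : Function.Injective fun n => l n ^ 2)
    (hrange : (Set.range fun n => l n ^ 2) = eigenvalues (robin a cp cm)) :
    ∃ (S : Set ℕ) (σ : ℕ → ℕ) (C : ℝ), Sᶜ.Finite ∧ Set.InjOn σ S ∧ (σ '' S)ᶜ.Finite ∧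
      ∀ n ∈ S, ‖phi a cm (l n) - cosVec a (σ n)‖ ≤ C / σ n := by
  set d := ‖cp - cm‖ with hd
  have hd0 : 0 ≤ d := norm_nonneg _
  -- The summands serve, in order, the dominance of the leading term, the separation of zeros,
  -- closeness 1/(8a) to the frequency, and comparability of frequency and |l|.
  set R : ℝ := domRadius cp cm + (48 * d + a) / a + 48 * d + 1 / a with hR
  have hia : 0 < 1 / a := by positivity
  have hq : 0 < (48 * d + a) / a := by positivity
  have hD : 1 ≤ domRadius cp cm := by
    unfold domRadius
    linarith [norm_nonneg (cp - cm), norm_nonneg (cp * cm)]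
  have hchar : ∀ n, charFun a cp cm (l n) = 0 := fun n =>
    charFun_eq_zero_of_mem_eigenvalues ha (hrange ▸ ⟨n, rfl⟩)
  have hsec : ∀ n, secular a cp cm (l n) = 0 := fun n => by rw [secular_eq, hchar, mul_zero]
  set S : Set ℕ := {n | R ≤ ‖l n‖} with hS
  have hnear : ∀ n, n ∈ S → ∃ (k : ℕ) (s : ℂ), (s = l n ∨ s = -l n) ∧
      ‖s - freq a k‖ ≤ 6 * d / a / ‖l n‖ := fun n hn =>
    exists_freq_near ha (hsec n) (by have : R ≤ ‖l n‖ := hn; linarith)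
  choose! σ s hs hσ using hnear
  have hsn : ∀ n ∈ S, ‖s n‖ = ‖l n‖ := fun n hn => by
    rcases hs n hn with h | h <;> rw [h]
    exact norm_neg _
  have hs2 : ∀ n ∈ S, s n ^ 2 = l n ^ 2 := fun n hn => by
    rcases hs n hn with h | h <;> rw [h]
    exact neg_sq _
  have hss : ∀ n ∈ S, secular a cp cm (s n) = 0 := fun n hn => by
    rcases hs n hn with h | h <;> rw [h]
    · exact hsec n
    · rw [secular_neg, hsec, neg_zero]
  have hsmall : ∀ n ∈ S, ‖s n - freq a (σ n)‖ ≤ 1 / a / 8 := fun n hn => by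
    have hn' : R ≤ ‖l n‖ := hn
    refine (hσ n hn).trans ?_
    rw [div_le_iff₀ (by linarith), div_le_iff₀ ha]
    have : 1 / a / 8 * ‖l n‖ * a = ‖l n‖ / 8 := by field_simp
    linarith
  have hσfreq : ∀ n ∈ S, ‖l n‖ / 2 ≤ freq a (σ n) ∧ freq a (σ n) ≤ 2 * ‖l n‖ := fun n hn => by
    have hn' : R ≤ ‖l n‖ := hn
    have hpos : 0 ≤ freq a (σ n) := by
      have := Real.pi_pos
      unfold freq
      positivity
    have h0 : ‖(freq a (σ n) : ℂ)‖ = freq a (σ n) := by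
      rw [Complex.norm_real, Real.norm_of_nonneg hpos]
    have h1 := norm_sub_norm_le (s n) (freq a (σ n))
    have h2 := norm_sub_norm_le (freq a (σ n) : ℂ) (s n)
    rw [norm_sub_rev] at h2
    have h3 := hsmall n hn
    rw [hsn n hn, h0] at h1 h2
    constructor <;> linarith
  obtain ⟨N, hN⟩ := exists_le_freq ha (2 * domRadius cp cm + 1 / a + 240 * d + R)
  have hex := fun (k : ℕ) (hk : N ≤ k) => exists_secular_eq_zero_near (cp := cp) (cm := cm) (k := k)
    ha (by linarith [hN k hk]) (by linarith [hN k hk]) (by linarith [hN k hk])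
  obtain ⟨C, hC0, hC⟩ := exists_norm_phi_sub_cosVec_le ha cm (6 * d / a)
  refine ⟨S, σ, C * (4 * a / Real.pi), ?_, ?_, ?_, ?_⟩
  · have hl : Function.Injective l := fun m n h => hinj (by simp only [h])
    refine ((finite_secular_zeros (hex N le_rfl).1 R).preimage hl.injOn).subset fun n hn => ?_
    have hn' : ¬R ≤ ‖l n‖ := hn
    exact ⟨hsec n, (not_le.1 hn').le⟩
  -- Two zeros assigned to one frequency are within 1/(4a), so separation identifies them.
  · intro m hm n hn hmn
    refine hinj ?_
    simp only
    have hm' : R ≤ ‖l m‖ := hm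
    have hn' : R ≤ ‖l n‖ := hn
    rw [← hs2 m hm, ← hs2 n hn]
    congr 1
    refine eq_of_secular_eq_zero ha (hss m hm) (hss n hn) (by rw [hsn m hm]; linarith)
      (by rw [hsn n hn]; linarith) ?_ ?_
    · rw [hsn m hm]
      have : (48 * d + a) / a ≤ ‖l m‖ := by linarith
      rw [div_le_iff₀ ha] at this
      linarith
    · have h1 := hsmall m hm
      have h2 := hsmall n hn
      rw [← hmn] at h2
      have h3 := norm_sub_le_norm_sub_add_norm_sub (s m) (freq a (σ m) : ℂ) (s n)
      rw [norm_sub_rev (freq a (σ m) : ℂ) (s n)] at h3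
      calc 2 * a * ‖s m - s n‖ ≤ 2 * a * (1 / a / 8 + 1 / a / 8) := by gcongr; linarith
        _ ≤ 1 := by
          field_simp
          norm_num
  -- For k ≥ N the zero near `freq a k` is `s n` or `-s n` for some n. Since 1/(8a) + 1/(2a) < 1/a
  -- is below the spacing π/(2a), its assigned frequency is the k-th.
  · refine (Set.finite_lt_nat N).subset fun k hk => ?_
    by_contra hNk
    have hNk : N ≤ k := not_lt.1 hNk
    obtain ⟨z, hz0, hz⟩ := (hex k hNk).2
    have hzR : R ≤ ‖z‖ := by
      have h1 := norm_sub_norm_le (freq a k : ℂ) z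
      rw [norm_sub_rev] at h1
      have h2 := hN k hNk
      rw [Complex.norm_real, Real.norm_of_nonneg (by linarith)] at h1
      have h3 : 1 / (2 * a) = 1 / a / 2 := by field_simp
      linarith
    have hzne : z ≠ 0 := norm_pos_iff.1 (by linarith)
    have hzc : charFun a cp cm z = 0 := by
      rw [secular_eq] at hz0
      exact (mul_eq_zero.1 hz0).resolve_left (neg_ne_zero.2 hzne)
    have hmem := mem_eigenvalues_of_charFun_eq_zero ha hzc
    rw [← hrange] at hmem
    obtain ⟨n, hn⟩ := hmem
    simp only at hn
    have hln : ‖l n‖ = ‖z‖ := by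
      have := congrArg norm hn
      rw [norm_pow, norm_pow] at this
      exact (pow_left_inj₀ (norm_nonneg _) (norm_nonneg _) two_ne_zero).1 this
    have hnS : n ∈ S := by
      change R ≤ ‖l n‖
      rwa [hln]
    refine hk ⟨n, hnS, ?_⟩
    have hsz : s n = z ∨ s n = -z := sq_eq_sq_iff_eq_or_eq_neg.1 ((hs2 n hnS).trans hn)
    have hsm := hsmall n hnS
    have h3 : 1 / (2 * a) = 1 / a / 2 := by field_simp
    rcases hsz with h | h
    · rw [h] at hsm
      have h4 := norm_sub_le_norm_sub_add_norm_sub (freq a (σ n) : ℂ) z (freq a k : ℂ)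
      rw [norm_sub_rev _ z] at h4
      exact_mod_cast eq_of_norm_freq_sub_lt ha (j := σ n) (k := k) (by linarith)
    · rw [h] at hsm
      have h5 : -z - freq a (σ n) = freq a (-(σ n : ℤ)) - z := by
        unfold freq
        push_cast
        ring
      rw [h5] at hsm
      have h4 := norm_sub_le_norm_sub_add_norm_sub (freq a (-(σ n : ℤ)) : ℂ) z (freq a k : ℂ)
      have := eq_of_norm_freq_sub_lt ha (j := -(σ n : ℤ)) (k := k) (by linarith)
      omega
  · intro n hn
    have hn' : R ≤ ‖l n‖ := hn
    have hl0 : 0 < ‖l n‖ := by linarith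
    obtain ⟨h1, h2⟩ := hσfreq n hn
    have hk0 : σ n ≠ 0 := fun h => by
      rw [h] at h1
      simp only [freq, Nat.cast_zero, Int.cast_zero, zero_mul, zero_div] at h1
      linarith
    have hphi : phi a cm (s n) = phi a cm (l n) := by
      rcases hs n hn with h | h <;> rw [h]
      exact phi_neg a cm _
    have h4 := hC (s n) (σ n) hk0 (norm_pos_iff.1 (by rwa [hsn n hn])) (by
      have := hsmall n hn
      calc 2 * a * ‖s n - freq a (σ n)‖ ≤ 2 * a * (1 / a / 8) := by gcongr
        _ ≤ 1 := by
          field_simp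
          norm_num) (by rw [hsn n hn]; exact hσ n hn)
    rw [hphi, hsn n hn] at h4
    refine h4.trans ?_
    have hσ0 : (0 : ℝ) < σ n := by exact_mod_cast Nat.pos_of_ne_zero hk0
    rw [mul_div_assoc, div_eq_mul_inv]
    refine mul_le_mul_of_nonneg_left ?_ hC0
    have hpi := Real.pi_pos
    rw [div_div, le_div_iff₀ (by positivity), inv_mul_le_iff₀ hl0]
    unfold freq at h2
    rw [div_le_iff₀ (by positivity)] at h2
    push_cast at h2
    linarith

end RobinLaplacian

end

open RobinLaplacian
theorem corollary3p3 (a : ℝ) (ha : 0 < a) (cp cm : ℂ)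
    -- all eigenvalues of `H` are simple
    (hsimple : ∀ z ∈ eigenvalues (robin a cp cm), IsSimpleEigenvalue (robin a cp cm) z)
    -- `n ↦ (l n)²` enumerates the eigenvalues of `H` without repetition
    (l : ℕ → ℂ) (hinj : Function.Injective fun n => l n ^ 2)
    (hrange : (Set.range fun n => l n ^ 2) = eigenvalues (robin a cp cm))
    -- an arbitrary orthonormal basis of `L²(-a, a)`
    (e : HilbertBasis ℕ ℂ (L2 a)) :
    -- the `φ_n` are eigenvectors of the adjoint operator
    (∀ n, IsEigenvector (robin a cp cm)† (conj (l n ^ 2)) (phi a cm (l n))) ∧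
    ∃ Ω Θ K : L2 a →L[ℂ] L2 a,
      -- `Ω = ∑ e_n ⟨φ_n, ·⟩`
      (∀ u, HasSum (fun n => ⟪phi a cm (l n), u⟫_ℂ • e n) (Ω u)) ∧
      Θ = ContinuousLinearMap.adjoint Ω ∘L Ω ∧
      -- `Θ = ∑ φ_n ⟨φ_n, ·⟩`
      (∀ u, HasSum (fun n => ⟪phi a cm (l n), u⟫_ℂ • phi a cm (l n)) (Θ u)) ∧
      Θ = ContinuousLinearMap.id ℂ (L2 a) + K ∧
      IsHilbertSchmidt K ∧
      ∃ k : ℝ × ℝ → ℂ, IsIntegralOperatorWithKernel K k := by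
  refine ⟨fun n => isEigenvector_adjoint ha
    (charFun_eq_zero_of_mem_eigenvalues ha (hrange ▸ ⟨n, rfl⟩)), ?_⟩
  obtain ⟨S, σ, C, hS, hσ, hfin, hC⟩ := exists_matching ha hinj hrange
  have hsum : Summable (S.indicator fun n => ‖phi a cm (l n) - cosBasis ha (σ n)‖ ^ 2) := by
    rw [coe_cosBasis, ← summable_subtype_iff_indicator]
    have h1 : Summable fun k : ℕ => C ^ 2 * (1 / (k : ℝ) ^ 2) :=
      (Real.summable_one_div_nat_pow.2 one_lt_two).mul_left _
    -- Injectivity of `σ` on `S` bounds the errors by a subseries of ∑ C²/k².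
    refine Summable.of_nonneg_of_le (fun n => sq_nonneg _) (fun n => ?_)
      (h1.comp_injective (i := fun n : S => σ n) fun m n h => Subtype.ext (hσ m.2 n.2 h))
    calc _ ≤ (C / σ n) ^ 2 := by
          simp only [Function.comp_apply]
          gcongr
          exact hC n n.2
      _ = _ := by
          simp only [Function.comp_apply]
          ring
  obtain ⟨Ω, Θ, K, hΩ, hΘ, hΘs, hK, hHS⟩ := exists_frame_operator e (cosBasis ha)
    (fun n => phi a cm (l n)) S hS σ hσ hfin hsum
  have : IsFiniteMeasure (intervalMeasure a) := ⟨by simp⟩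
  obtain ⟨k, hk⟩ := hHS.exists_kernel
  exact ⟨Ω, Θ, K, hΩ, hΘ, hΘs, hK, hHS, k, hk⟩
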